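/- There is an absolute constant $C$ such that the following holds for every finite simple connected graph $G=(N,E)$ with $m=|E|$ edges in which every node has degree at least $2$ and which is not a cycle (i.e. some node has degree at least $3$). An orientation $x$ gives each edge $\{v,w\}$ one of the directions $(v,w)$ (leaving $v$, entering $w$) and $(w,v)$. Choosing an edge uniformly and one of its two directions with probability $1/2$ each is called a draw $(v,w)$. The Gibbs update of $x$ with the draw $(v,w)$ sets $x(\{v,w\})=(v,w)$ if some edge other than $\{v,w\}$ leaves $w$ in $x$, and leaves $x$ unchanged otherwise. A bounding state $y$ gives each edge a nonempty set of possible directions; an edge is known if this set has one element and unknown otherwise. The bounding update of $y$ with the draw $(v,w)$ is: if some edge other than $\{v,w\}$ is known to leave $w$, set $y(\{v,w\})=\{(v,w)\}$; otherwise, if some edge other than $\{v,w\}$ at $w$ is unknown, replace $y(\{v,w\})$ by $y(\{v,w\})\cup\{(v,w)\}$; otherwise leave $y$ unchanged. The three-phase scheme uses independent draws and starts in Phase I. Phase I is one step: given a draw $(v,w)$, let $y^1$ be the state in which $\{v,w\}$ is known to be $(v,w)$ and all other edges are unknown, and let $y^2$ be the state in which $\{v,w\}$ is known to be $(w,v)$,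 all other edges at $w$ are known to enter $w$, and all remaining edges are unknown; go to Phase II with $(y^1,y^2)$. In each step of Phase II both states are updated by the bounding update, with two independent draws; if afterwards all edges are unknown in at least one of the two states, return to Phase I, and if all edges are known in both states, go to Phase III with the two orientations so determined. In each step of Phase III both orientations are updated by the Gibbs update with the same draw. Complete coupling is detected at the first time at which the scheme is in Phase III and the two orientations are equal. Then the expected number of steps until complete coupling is detected is at most $C\,m^9$. -/

import Mathlib

open MeasureTheory ProbabilityTheory
open scoped ENNReal

/-!
Directed edges of a graph `G` are its darts: `d = (d.fst, d.snd)` is the edge `d.edge` directed out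
of `d.fst` and into `d.snd`, and `d.symm` is the same edge with the opposite direction.

An orientation is encoded as the set of the darts it uses.  A bounding state `y`, which assigns to
each edge a nonempty subset of its two directions, is encoded as the set of all directions that it
allows; so `y({v,w})` is the intersection of `y` with `{(v,w), (w,v)}`.  A bounding state all of
whose edges are known is the same set of darts as the one orientation that it bounds.
-/

namespace SinkFree

variable {V : Type*} {G : SimpleGraph V}

/-- The finite set of darts is given the discrete σ-algebra. -/
instance instMeasurableSpaceDart : MeasurableSpace G.Dart := ⊤

instance instDiscreteMeasurableSpaceDart : DiscreteMeasurableSpace G.Dart := ⟨fun _ => trivial⟩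

variable [Fintype V] [DecidableEq V] [DecidableRel G.Adj]

/-- One step of the complete coupling for the Gibbs sampler.  The draw `d = (v, w)` stands for
choosing the edge `{v, w}` and trying to direct it from `v` to `w`; this is done if `w` is not a
sink once that edge is removed, that is, if another edge leaves `w` in `x`. -/
def gibbsStep (x : Finset G.Dart) (d : G.Dart) : Finset G.Dart :=
  if ∃ d' ∈ x, d'.fst = d.snd ∧ d'.edge ≠ d.edge then insert d (x.erase d.symm) else x

/-- The edge of `d` is known in `y` to have the direction `d`. -/
def IsKnown (y : Finset G.Dart) (d : G.Dart) : Prop := d ∈ y ∧ d.symm ∉ y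

/-- The edge of `d` is unknown in `y`: both directions are possible. -/
def IsUnknown (y : Finset G.Dart) (d : G.Dart) : Prop := d ∈ y ∧ d.symm ∈ y

instance instDecidableIsKnown (y : Finset G.Dart) (d : G.Dart) : Decidable (IsKnown y d) :=
  inferInstanceAs (Decidable (_ ∧ _))

instance instDecidableIsUnknown (y : Finset G.Dart) (d : G.Dart) : Decidable (IsUnknown y d) :=
  inferInstanceAs (Decidable (_ ∧ _))

/-- One step of the bounding chain, for the draw `d = (v, w)`.
* If another edge is known to leave `w`, then `{v, w}` becomes known with direction `(v, w)`.
* Otherwise, if another edge at `w` is unknown, the attempt may or may not succeed, and `(v, w)` is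
  added to the possible directions of `{v, w}`: the edge becomes (or stays) unknown, unless it was
  already known to have the direction `(v, w)`, in which case nothing changes.
* Otherwise all other edges at `w` are known to enter `w`, and nothing changes. -/
def boundingStep (y : Finset G.Dart) (d : G.Dart) : Finset G.Dart :=
  if ∃ d', IsKnown y d' ∧ d'.fst = d.snd ∧ d'.edge ≠ d.edge then insert d (y.erase d.symm)
  else if ∃ d', IsUnknown y d' ∧ d'.fst = d.snd ∧ d'.edge ≠ d.edge then insert d y
  else y

/-- First starting state for the draw `d = (v, w)`: the edge `{v, w}` is known to be `(v, w)`,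
every other edge is unknown. -/
def startSuccess (d : G.Dart) : Finset G.Dart := Finset.univ.erase d.symm

/-- Second starting state for the draw `d = (v, w)`: the edge `{v, w}` is known to be `(w, v)`, all
other edges at `w` are known to enter `w`, and every other edge is unknown. -/
def startFailure (d : G.Dart) : Finset G.Dart :=
  Finset.univ.filter fun d' => d' = d.symm ∨ (d'.fst ≠ d.snd ∧ d' ≠ d)

/-- Every edge is unknown. -/
def AllUnknown (y : Finset G.Dart) : Prop := ∀ d, IsUnknown y d

/-- Every edge is known: the bounding process has detected complete coupling. -/
def AllKnown (y : Finset G.Dart) : Prop := ∀ d, ¬ IsUnknown y d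

instance instDecidableAllUnknown (y : Finset G.Dart) : Decidable (AllUnknown y) :=
  inferInstanceAs (Decidable (∀ _, _))

instance instDecidableAllKnown (y : Finset G.Dart) : Decidable (AllKnown y) :=
  inferInstanceAs (Decidable (∀ _, _))

variable (G) in
/-- States of the three-phase scheme: nothing is recorded in Phase I, two bounding states in
Phase II, two orientations in Phase III. -/
inductive SchemeState where
  | phaseI : SchemeState
  | phaseII (y₁ y₂ : Finset G.Dart) : SchemeState
  | phaseIII (x₁ x₂ : Finset G.Dart) : SchemeState

/-- One step of the scheme.  A step is given two draws.  Phases I and III use only the first one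
(in Phase III for both orientations), and in Phase II each bounding process uses its own draw.
Phase II goes back to Phase I as soon as one of the two processes is in the all-unknown state, and
on to Phase III as soon as all edges are known in both. -/
def schemeStep : SchemeState G → G.Dart × G.Dart → SchemeState G
  | .phaseI, d => .phaseII (startSuccess d.1) (startFailure d.1)
  | .phaseII y₁ y₂, d =>
      let z₁ := boundingStep y₁ d.1
      let z₂ := boundingStep y₂ d.2
      if AllUnknown z₁ ∨ AllUnknown z₂ then .phaseI
      else if AllKnown z₁ ∧ AllKnown z₂ then .phaseIII z₁ z₂
      else .phaseII z₁ z₂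
  | .phaseIII x₁ x₂, d => .phaseIII (gibbsStep x₁ d.1) (gibbsStep x₂ d.1)

/-- The scheme, started in Phase I and run on a given sequence of draws. -/
def schemeRun (draw : ℕ → G.Dart × G.Dart) : ℕ → SchemeState G
  | 0 => .phaseI
  | t + 1 => schemeStep (schemeRun draw t) (draw t)

/-- Complete coupling has been detected: the two orientations of Phase III agree. -/
def SchemeState.Detected : SchemeState G → Prop
  | .phaseI => False
  | .phaseII _ _ => False
  | .phaseIII x₁ x₂ => x₁ = x₂

/-- The number of steps until complete coupling is detected (`⊤` if that never happens). -/
noncomputable def detectionTime (draw : ℕ → G.Dart × G.Dart) : ℕ∞ :=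
  ⨅ (t : ℕ) (_ : (schemeRun draw t).Detected), (t : ℕ∞)

end SinkFree

namespace SinkFree

section Darts

variable {V : Type*} {G : SimpleGraph V}

lemma edge_eq_iff_of_fst_eq {d e : G.Dart} (h : e.fst = d.fst) : e.edge = d.edge ↔ e = d := by
  rw [SimpleGraph.dart_edge_eq_iff]
  refine ⟨?_, Or.inl⟩
  rintro (h' | rfl)
  · exact h'
  · exact absurd h d.fst_ne_snd.symm

lemma edge_eq_iff_of_fst_eq_snd {d e : G.Dart} (h : e.fst = d.snd) :
    e.edge = d.edge ↔ e = d.symm := by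
  rw [← edge_eq_iff_of_fst_eq (d := d.symm) h, SimpleGraph.Dart.edge_symm]

end Darts

variable {V : Type*} {G : SimpleGraph V}

lemma isUnknown_symm {y : Finset G.Dart} {d : G.Dart} : IsUnknown y d.symm ↔ IsUnknown y d := by
  simp [IsUnknown, and_comm]

lemma IsKnown.not_isUnknown {y : Finset G.Dart} {d : G.Dart} (h : IsKnown y d) :
    ¬ IsUnknown y d := fun h' => h.2 h'.2

lemma isUnknown_of_edge_eq {y : Finset G.Dart} {d e : G.Dart} (h : e.edge = d.edge) :
    IsUnknown y e ↔ IsUnknown y d := by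
  rcases (SimpleGraph.dart_edge_eq_iff _ _).1 h with rfl | rfl
  · rfl
  · exact isUnknown_symm

lemma isUnknown_congr_of_edge_ne {y z : Finset G.Dart} {d e : G.Dart}
    (h : ∀ e : G.Dart, e.edge ≠ d.edge → (e ∈ z ↔ e ∈ y)) (he : e.edge ≠ d.edge) :
    IsUnknown z e ↔ IsUnknown y e := by
  have := h e.symm (by simpa using he)
  simp [IsUnknown, h e he, this]

lemma isKnown_congr_of_edge_ne {y z : Finset G.Dart} {d e : G.Dart}
    (h : ∀ e : G.Dart, e.edge ≠ d.edge → (e ∈ z ↔ e ∈ y)) (he : e.edge ≠ d.edge) :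
    IsKnown z e ↔ IsKnown y e := by
  have := h e.symm (by simpa using he)
  simp [IsKnown, h e he, this]

/-- Some edge at `v` is unknown. -/
def HasUnknown (y : Finset G.Dart) (v : V) : Prop := ∃ d, d.fst = v ∧ IsUnknown y d

/-- Some known edge leaves `v`, and it may be reversed without `v` turning into a vertex all of
whose edges are known to enter it. -/
def HasToken (y : Finset G.Dart) (v : V) : Prop :=
  ∃ d, d.fst = v ∧ IsKnown y d ∧ (HasUnknown y v ∨ ∃ d', d'.fst = v ∧ IsKnown y d' ∧ d' ≠ d)

/-- The distance from `v` to the closest vertex with an unknown edge. -/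
noncomputable def gap (y : Finset G.Dart) (v : V) : ℕ :=
  sInf {k | ∃ s, HasUnknown y s ∧ G.dist v s = k}

/-- The smallest distance between a vertex with a token and a vertex with an unknown edge. -/
noncomputable def level (y : Finset G.Dart) : ℕ := sInf {k | ∃ v, HasToken y v ∧ gap y v = k}

/-- Every edge has a possible direction, and no vertex is known to be a sink. -/
structure IsBounding (y : Finset G.Dart) : Prop where
  total : ∀ d, d ∈ y ∨ d.symm ∈ y
  noSink : ∀ v, HasUnknown y v ∨ ∃ d, d.fst = v ∧ IsKnown y d

lemma IsBounding.isKnown_or {y : Finset G.Dart} (hy : IsBounding y) {d : G.Dart}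
    (h : ¬ IsUnknown y d) : IsKnown y d ∨ IsKnown y d.symm := by
  have := hy.total d
  simp only [IsUnknown, IsKnown, SimpleGraph.Dart.symm_symm] at *
  tauto

section Gap

variable {y : Finset G.Dart}

lemma hasUnknown_congr {z : Finset G.Dart} (h : ∀ e, IsUnknown z e ↔ IsUnknown y e) (v : V) :
    HasUnknown z v ↔ HasUnknown y v := by
  simp [HasUnknown, h]

lemma gap_congr {z : Finset G.Dart} (h : ∀ e, IsUnknown z e ↔ IsUnknown y e) (v : V) : gap z v = gap y v := by
  simp [gap, hasUnknown_congr h]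

lemma gap_le_dist {v s : V} (hs : HasUnknown y s) : gap y v ≤ G.dist v s := Nat.sInf_le ⟨s, hs, rfl⟩

lemma exists_dist_eq_gap (hne : ∃ s, HasUnknown y s) (v : V) :
    ∃ s, HasUnknown y s ∧ G.dist v s = gap y v := by
  obtain ⟨s, hs⟩ := hne
  exact Nat.sInf_mem (s := {k | ∃ s, HasUnknown y s ∧ G.dist v s = k}) ⟨_, s, hs, rfl⟩

lemma gap_eq_zero {v : V} (hv : HasUnknown y v) : gap y v = 0 := by
  have := gap_le_dist (v := v) hv
  simpa using this

lemma hasUnknown_of_gap_eq_zero (hconn : G.Connected) (hne : ∃ s, HasUnknown y s) {v : V}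
    (h : gap y v = 0) : HasUnknown y v := by
  obtain ⟨s, hs, hd⟩ := exists_dist_eq_gap hne v
  rw [h, hconn.dist_eq_zero_iff] at hd
  rwa [hd]

lemma gap_le_succ_of_adj (hconn : G.Connected) (hne : ∃ s, HasUnknown y s) {u v : V}
    (h : G.Adj u v) : gap y u ≤ gap y v + 1 := by
  obtain ⟨s, hs, hd⟩ := exists_dist_eq_gap hne v
  have h1 := hconn.dist_triangle (u := u) (v := v) (w := s)
  have h2 := gap_le_dist (v := u) hs
  have h3 : G.dist u v = 1 := SimpleGraph.dist_eq_one_iff_adj.2 h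
  omega

lemma exists_dart_gap_succ_eq (hconn : G.Connected) (hne : ∃ s, HasUnknown y s) {v : V}
    (hv : ¬ HasUnknown y v) : ∃ g : G.Dart, g.fst = v ∧ gap y g.snd + 1 = gap y v := by
  obtain ⟨s, hs, hd⟩ := exists_dist_eq_gap hne v
  obtain ⟨p, hp⟩ := hconn.exists_walk_length_eq_dist v s
  cases p with
  | nil => exact absurd hs hv
  | @cons _ u _ h p =>
    refine ⟨⟨(v, u), h⟩, rfl, ?_⟩
    have h1 := gap_le_dist (v := u) hs
    have h2 := SimpleGraph.dist_le p
    have h3 := gap_le_succ_of_adj hconn hne h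
    rw [SimpleGraph.Walk.length_cons] at hp
    change gap y u + 1 = _
    omega

lemma gap_le_card [Fintype V] (hconn : G.Connected) (y : Finset G.Dart) (v : V) :
    gap y v ≤ Fintype.card V := by
  by_cases hne : ∃ s, HasUnknown y s
  · obtain ⟨s, hs, hd⟩ := exists_dist_eq_gap hne v
    obtain ⟨p, hp, hl⟩ := hconn.exists_path_of_dist v s
    have := hp.length_lt
    omega
  · have : {k | ∃ s, HasUnknown y s ∧ G.dist v s = k} = ∅ := by
      ext k; simp only [Set.mem_ofPred_eq, Set.mem_empty_iff_false, iff_false]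
      rintro ⟨s, hs, -⟩; exact hne ⟨s, hs⟩
    simp [gap, this]

lemma level_le_gap {v : V} (hv : HasToken y v) : level y ≤ gap y v := Nat.sInf_le ⟨v, hv, rfl⟩

lemma exists_gap_eq_level (h : ∃ v, HasToken y v) : ∃ v, HasToken y v ∧ gap y v = level y := by
  obtain ⟨v, hv⟩ := h
  exact Nat.sInf_mem (s := {k | ∃ v, HasToken y v ∧ gap y v = k}) ⟨_, v, hv, rfl⟩

lemma level_eq_zero_of_not_exists (h : ¬ ∃ v, HasToken y v) : level y = 0 := by
  have : {k | ∃ v, HasToken y v ∧ gap y v = k} = ∅ := by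
    ext k; simp only [Set.mem_ofPred_eq, Set.mem_empty_iff_false, iff_false]
    rintro ⟨s, hs, -⟩; exact h ⟨s, hs⟩
  simp [level, this]

lemma level_le_card [Fintype V] (hconn : G.Connected) (y : Finset G.Dart) :
    level y ≤ Fintype.card V := by
  by_cases h : ∃ v, HasToken y v
  · obtain ⟨v, -, hv⟩ := exists_gap_eq_level h
    exact hv ▸ gap_le_card hconn y v
  · simp [level_eq_zero_of_not_exists h]

lemma level_eq_zero_of_allKnown (h : AllKnown y) : level y = 0 := by
  by_cases ht : ∃ v, HasToken y v
  · obtain ⟨v, -, hv⟩ := exists_gap_eq_level ht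
    rw [← hv]
    have : {k | ∃ s, HasUnknown y s ∧ G.dist v s = k} = ∅ := by
      ext k; simp only [Set.mem_ofPred_eq, Set.mem_empty_iff_false, iff_false]
      rintro ⟨s, ⟨d, -, hd⟩, -⟩; exact h d hd
    simp [gap, this]
  · exact level_eq_zero_of_not_exists ht

/-- Below the level of the closest token, every edge is known to point towards the unknown
edges. -/
lemma isKnown_of_gap_succ_eq (hconn : G.Connected) (hne : ∃ s, HasUnknown y s)
    (hy : IsBounding y) (n : ℕ) : ∀ g : G.Dart, gap y g.fst = n → n ≤ level y →
      gap y g.snd + 1 = n → IsKnown y g := by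
  induction n using Nat.strong_induction_on with
  | _ n ih =>
    intro g hg hn hs
    have hfst : ¬ HasUnknown y g.fst := fun h => by have := gap_eq_zero h; omega
    rcases hy.isKnown_or (d := g) fun h => hfst ⟨g, rfl, h⟩ with h | h
    · exact h
    · exfalso
      have key : HasToken y g.snd := by
        refine ⟨g.symm, rfl, h, ?_⟩
        by_cases hu : HasUnknown y g.snd
        · exact Or.inl hu
        · obtain ⟨g', hg', hgap⟩ := exists_dart_gap_succ_eq hconn hne hu
          refine Or.inr ⟨g', hg', ih (n - 1) (by omega) g' (by rw [hg']; omega) (by omega)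
            (by omega), ?_⟩
          rintro rfl
          change gap y g.fst + 1 = _ at hgap
          omega
      have := level_le_gap key
      omega

end Gap

section Settled

variable [Fintype V] [DecidableEq V] [DecidableRel G.Adj]

/-- The darts whose edge is known; every known edge contributes two of them. -/
def settled (y : Finset G.Dart) : Finset G.Dart := Finset.univ.filter fun d => ¬ IsUnknown y d

@[simp]
lemma mem_settled {y : Finset G.Dart} {d : G.Dart} : d ∈ settled y ↔ ¬ IsUnknown y d := by
  simp [settled]

lemma card_settled_le (y : Finset G.Dart) : (settled y).card ≤ Fintype.card G.Dart :=
  Finset.card_le_univ _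

lemma AllKnown.card_settled {y : Finset G.Dart} (h : AllKnown y) :
    (settled y).card = Fintype.card G.Dart := by
  rw [settled, Finset.filter_true_of_mem fun d _ => h d, Finset.card_univ]

lemma AllUnknown.card_settled {y : Finset G.Dart} (h : AllUnknown y) : (settled y).card = 0 := by
  rw [settled, Finset.filter_false_of_mem fun d _ => not_not.2 (h d), Finset.card_empty]

lemma card_settled_pos {y : Finset G.Dart} (h : ¬ AllUnknown y) : 0 < (settled y).card := by
  simp only [AllUnknown, not_forall] at h
  obtain ⟨d, hd⟩ := h
  exact Finset.card_pos.2 ⟨d, by simpa using hd⟩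

lemma settled_eq_of_iff {y z : Finset G.Dart} {d : G.Dart}
    (h : ∀ e : G.Dart, e.edge ≠ d.edge → (e ∈ z ↔ e ∈ y)) (hd : IsUnknown z d ↔ IsUnknown y d) :
    settled z = settled y := by
  ext e
  rw [mem_settled, mem_settled, not_iff_not]
  by_cases he : e.edge = d.edge
  · rw [isUnknown_of_edge_eq he, isUnknown_of_edge_eq he, hd]
  · exact isUnknown_congr_of_edge_ne h he

lemma card_settled_eq_add_two {y z : Finset G.Dart} {d : G.Dart}
    (h : ∀ e : G.Dart, e.edge ≠ d.edge → (e ∈ z ↔ e ∈ y)) (hy : IsUnknown y d)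
    (hz : ¬ IsUnknown z d) : (settled z).card = (settled y).card + 2 := by
  have : settled z = settled y ∪ {d, d.symm} := by
    ext e
    by_cases he : e.edge = d.edge
    · have h1 := (isUnknown_of_edge_eq (y := z) he).not.2 hz
      have h2 := (SimpleGraph.dart_edge_eq_iff _ _).1 he
      simp only [mem_settled, Finset.mem_union, Finset.mem_insert, Finset.mem_singleton, h1]
      tauto
    · have h1 := isUnknown_congr_of_edge_ne h he
      have h2 := mt (SimpleGraph.dart_edge_eq_iff e d).2 he
      simp only [mem_settled, Finset.mem_union, Finset.mem_insert, Finset.mem_singleton, h1, h2,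
        or_false]
  rw [this, Finset.card_union_of_disjoint, Finset.card_pair d.symm_ne.symm]
  rw [Finset.disjoint_right]
  simp [hy, isUnknown_symm]

/-- If no vertex has a token, then either all edges are known or all edges are unknown. -/
lemma allUnknown_of_not_exists_hasToken (hconn : G.Connected) (hdeg : ∀ v, 2 ≤ G.degree v)
    {y : Finset G.Dart} (hy : IsBounding y) (hne : ¬ AllKnown y) (h : ¬ ∃ v, HasToken y v) :
    AllUnknown y := by
  classical
  by_contra hall
  set R : Finset V := Finset.univ.filter fun v => ¬ HasUnknown y v with hR
  set K : Finset G.Dart := Finset.univ.filter fun d => IsKnown y d with hK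
  set A : Finset G.Dart := Finset.univ.filter fun d => d.fst ∈ R with hA
  have hKR : K.card ≤ R.card := by
    refine Finset.card_le_card_of_injOn (fun d => d.fst) ?_ ?_
    · intro d hd
      simp only [hK, Finset.coe_filter, Finset.mem_univ, true_and, Set.mem_ofPred_eq] at hd
      simp only [hR, Finset.coe_filter, Finset.mem_univ, true_and, Set.mem_ofPred_eq]
      exact fun hu => h ⟨d.fst, d, rfl, hd, Or.inl hu⟩
    · intro d hd e he hde
      simp only [hK, Finset.coe_filter, Finset.mem_univ, true_and, Set.mem_ofPred_eq] at hd he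
      by_contra hn
      exact h ⟨e.fst, e, rfl, he, Or.inr ⟨d, hde, hd, hn⟩⟩
  have hsK : (settled y).card ≤ 2 * K.card := by
    have : settled y ⊆ K ∪ K.image SimpleGraph.Dart.symm := by
      intro d hd
      rcases hy.isKnown_or (mem_settled.1 hd) with h | h
      · simp [hK, h]
      · refine Finset.mem_union_right _ (Finset.mem_image.2 ⟨d.symm, by simp [hK, h], by simp⟩)
    calc (settled y).card ≤ _ := Finset.card_le_card this
      _ ≤ K.card + (K.image SimpleGraph.Dart.symm).card := Finset.card_union_le _ _
      _ ≤ 2 * K.card := by have := Finset.card_image_le (s := K) (f := SimpleGraph.Dart.symm); omega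
  have hAcard : 2 * R.card ≤ A.card := by
    rw [Finset.card_eq_sum_card_fiberwise (s := A) (t := R) (f := fun d => d.fst)
      (fun d hd => by simpa [hA] using hd), mul_comm, ← smul_eq_mul]
    refine Finset.card_nsmul_le_sum _ _ _ fun v hv => ?_
    rw [Finset.filter_filter, Finset.filter_congr (q := fun d : G.Dart => d.fst = v),
      G.dart_fst_fiber_card_eq_degree]
    · exact hdeg v
    · intro d _
      exact ⟨fun h => h.2, fun h => ⟨h ▸ hv, h⟩⟩
  have hAs : A ⊆ settled y := by
    intro d hd
    simp only [hA, hR, Finset.mem_filter, Finset.mem_univ, true_and] at hd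
    exact mem_settled.2 fun hu => hd ⟨d, rfl, hu⟩
  have heq : A = settled y := Finset.eq_of_subset_of_card_le hAs (by omega)
  have hmem : ∀ d : G.Dart, ¬ IsUnknown y d → ¬ HasUnknown y d.fst := by
    intro d hd
    have : d ∈ A := heq ▸ mem_settled.2 hd
    simpa [hA, hR] using this
  simp only [AllUnknown, AllKnown, not_forall, not_not] at hall hne
  obtain ⟨d, hd⟩ := hall
  obtain ⟨e, he⟩ := hne
  obtain ⟨p⟩ := hconn.preconnected d.fst e.fst
  obtain ⟨g, -, hg1, hg2⟩ := p.exists_boundary_dart {v | ¬ HasUnknown y v} (hmem d hd)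
    (by simpa using ⟨e, rfl, he⟩)
  simp only [Set.mem_ofPred_eq, not_not] at hg1 hg2
  have hgu : ¬ IsUnknown y g := fun hu => hg1 ⟨g, rfl, hu⟩
  exact hmem g.symm (mt isUnknown_symm.1 hgu) hg2

end Settled

end SinkFree

namespace SinkFree

variable {V : Type*} {G : SimpleGraph V} [DecidableEq V]

/-- `f d` is a possible successor of the bounding state `y` for the draw `d`: only the edge of `d`
changes, and this follows the rules of `boundingStep`, except that an unknown edge may become known
even if no other edge is known to leave `d.snd`. -/
structure IsRefinement (y : Finset G.Dart) (f : G.Dart → Finset G.Dart) : Prop where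
  total : ∀ d e, e ∈ f d ∨ e.symm ∈ f d
  local_iff : ∀ d e : G.Dart, e.edge ≠ d.edge → (e ∈ f d ↔ e ∈ y)
  success : ∀ d : G.Dart, (∃ d', IsKnown y d' ∧ d'.fst = d.snd ∧ d'.edge ≠ d.edge) →
    f d = insert d (y.erase d.symm)
  failure : ∀ d : G.Dart, (¬ ∃ d', IsKnown y d' ∧ d'.fst = d.snd ∧ d'.edge ≠ d.edge) →
    (¬ ∃ d', IsUnknown y d' ∧ d'.fst = d.snd ∧ d'.edge ≠ d.edge) → f d = y
  keep : ∀ d : G.Dart, (¬ ∃ d', IsKnown y d' ∧ d'.fst = d.snd ∧ d'.edge ≠ d.edge) →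
    IsKnown y d → f d = y

lemma isKnown_insert_erase (y : Finset G.Dart) (d : G.Dart) :
    IsKnown (insert d (y.erase d.symm)) d := by
  simp [IsKnown, d.symm_ne]

lemma insert_erase_eq_of_isKnown {y : Finset G.Dart} {d : G.Dart} (h : IsKnown y d) :
    insert d (y.erase d.symm) = y := by
  rw [Finset.erase_eq_of_notMem h.2, Finset.insert_eq_of_mem h.1]

lemma mem_insert_erase_of_edge_ne {y : Finset G.Dart} {d e : G.Dart} (h : e.edge ≠ d.edge) :
    e ∈ insert d (y.erase d.symm) ↔ e ∈ y := by
  have h1 : e ≠ d := fun h' => h (by rw [h'])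
  have h2 : e ≠ d.symm := fun h' => h (by rw [h', SimpleGraph.Dart.edge_symm])
  simp [h1, h2]

section Flip

variable {y z : Finset G.Dart} {d : G.Dart}

/-- Reversing a known edge keeps the unknown edges. -/
lemma isUnknown_flip (hd : IsKnown y d.symm) (e : G.Dart) :
    IsUnknown (insert d (y.erase d.symm)) e ↔ IsUnknown y e := by
  by_cases he : e.edge = d.edge
  · rw [isUnknown_of_edge_eq he, isUnknown_of_edge_eq he, ← isUnknown_symm (y := y)]
    simp [(isKnown_insert_erase y d).not_isUnknown, hd.not_isUnknown]
  · exact isUnknown_congr_of_edge_ne (fun _ => mem_insert_erase_of_edge_ne) he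

lemma isKnown_flip_of_ne {e : G.Dart} (he : IsKnown y e) (hne : e ≠ d.symm) :
    IsKnown (insert d (y.erase d.symm)) e := by
  by_cases h : e = d
  · exact h ▸ isKnown_insert_erase y d
  · rw [isKnown_congr_of_edge_ne (fun _ => mem_insert_erase_of_edge_ne)]
    · exact he
    · rw [Ne, SimpleGraph.dart_edge_eq_iff]; tauto

lemma hasToken_flip_fst (hy : IsBounding y) (hd : IsKnown y d.symm) :
    HasToken (insert d (y.erase d.symm)) d.fst := by
  refine ⟨d, rfl, isKnown_insert_erase y d, ?_⟩
  rcases hy.noSink d.fst with h | ⟨e, he, hk⟩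
  · exact Or.inl ((hasUnknown_congr (isUnknown_flip hd) _).2 h)
  · refine Or.inr ⟨e, he, isKnown_flip_of_ne hk ?_, ?_⟩
    · rintro rfl; exact d.fst_ne_snd he.symm
    · rintro rfl; exact hd.2 (by simpa using hk.1)

lemma hasToken_flip_of_ne (hd : IsKnown y d.symm) {v : V} (hv : HasToken y v) (hne : v ≠ d.snd) :
    HasToken (insert d (y.erase d.symm)) v := by
  obtain ⟨e, rfl, he, h⟩ := hv
  refine ⟨e, rfl, isKnown_flip_of_ne he ?_, ?_⟩
  · rintro rfl; exact hne rfl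
  · rcases h with h | ⟨e', he', hk, hn⟩
    · exact Or.inl ((hasUnknown_congr (isUnknown_flip hd) _).2 h)
    · refine Or.inr ⟨e', he', isKnown_flip_of_ne hk ?_, hn⟩
      rintro rfl; exact hne he'.symm

end Flip

namespace IsRefinement

variable {y : Finset G.Dart} {f : G.Dart → Finset G.Dart}

/-- As long as the tokens stay away from the unknown edges, a step that leaves the set of unknown
edges as it is either changes nothing or reverses a known edge at a token. -/
lemma eq_or_flip (hf : IsRefinement y f) (hy : IsBounding y)
    (hl : 1 ≤ level y) {d : G.Dart} (hd : IsUnknown (f d) d ↔ IsUnknown y d) :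
    f d = y ∨ (f d = insert d (y.erase d.symm) ∧ IsKnown y d.symm ∧
      ∃ d', d'.fst = d.snd ∧ IsKnown y d' ∧ d' ≠ d.symm) := by
  by_cases hs : ∃ d', IsKnown y d' ∧ d'.fst = d.snd ∧ d'.edge ≠ d.edge
  · obtain ⟨d', hk, hfst, hedge⟩ := hs
    have hfd := hf.success d ⟨d', hk, hfst, hedge⟩
    have hdu : ¬ IsUnknown y d := by
      rw [← hd, hfd]; exact (isKnown_insert_erase y d).not_isUnknown
    rcases hy.isKnown_or hdu with h | h
    · left; rw [hfd, insert_erase_eq_of_isKnown h]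
    · exact Or.inr ⟨hfd, h, d', hfst, hk, fun h' => hedge (by rw [h', SimpleGraph.Dart.edge_symm])⟩
  · left
    by_cases hu : ∃ d', IsUnknown y d' ∧ d'.fst = d.snd ∧ d'.edge ≠ d.edge
    · obtain ⟨d', hu, hfst, hedge⟩ := hu
      by_cases hdu : IsUnknown y d
      · have := hd.2 hdu
        ext e
        by_cases he : e.edge = d.edge
        · rcases (SimpleGraph.dart_edge_eq_iff _ _).1 he with rfl | rfl
          · exact iff_of_true this.1 hdu.1
          · exact iff_of_true this.2 hdu.2
        · exact hf.local_iff d e he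
      · rcases hy.isKnown_or hdu with h | h
        · exact hf.keep d hs h
        · exfalso
          have ht : HasToken y d.snd := ⟨d.symm, rfl, h, Or.inl ⟨d', hfst, hu⟩⟩
          have h1 := level_le_gap ht
          rw [gap_eq_zero ⟨d', hfst, hu⟩] at h1
          omega
    · exact hf.failure d hs hu

/-- Some draw brings a token closer to the unknown edges. -/
lemma exists_level_lt (hf : IsRefinement y f) (hy : IsBounding y) (hconn : G.Connected)
    (hne : ¬ AllKnown y) (hl : 1 ≤ level y) :
    ∃ d, (IsUnknown (f d) d ↔ IsUnknown y d) ∧ level (f d) + 1 ≤ level y := by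
  have hne' : ∃ s, HasUnknown y s := by
    simp only [AllKnown, not_forall, not_not] at hne
    obtain ⟨d, hd⟩ := hne
    exact ⟨d.fst, d, rfl, hd⟩
  have ht : ∃ v, HasToken y v := by
    by_contra h; rw [level_eq_zero_of_not_exists h] at hl; omega
  obtain ⟨v, hv, hgap⟩ := exists_gap_eq_level ht
  have hvu : ¬ HasUnknown y v := fun h => by rw [gap_eq_zero h] at hgap; omega
  obtain ⟨g, rfl, hg⟩ := exists_dart_gap_succ_eq hconn hne' hvu
  have hk := isKnown_of_gap_succ_eq hconn hne' hy _ g rfl hgap.le hg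
  have hother : ∃ d', d'.fst = g.fst ∧ IsKnown y d' ∧ d' ≠ g := by
    obtain ⟨e, he, hek, h⟩ := hv
    rcases h with h | ⟨e', he', hek', hn⟩
    · exact absurd h hvu
    · by_cases h : e = g
      · exact ⟨e', he', hek', h ▸ hn⟩
      · exact ⟨e, he, hek, h⟩
  obtain ⟨d', hd', hdk, hn⟩ := hother
  have hfd := hf.success g.symm ⟨d', hdk, hd', by
    rw [SimpleGraph.Dart.edge_symm, Ne, edge_eq_iff_of_fst_eq hd']; exact hn⟩
  have hk' : IsKnown y g.symm.symm := by simpa using hk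
  refine ⟨g.symm, by rw [hfd]; exact isUnknown_flip hk' _, ?_⟩
  rw [hfd]
  have h1 := level_le_gap (hasToken_flip_fst hy hk')
  rw [gap_congr (isUnknown_flip hk')] at h1
  change _ ≤ gap y g.snd at h1
  omega

/-- At most one draw moves the last of the closest tokens away from the unknown edges. -/
lemma level_le_succ_and_unique (hf : IsRefinement y f) (hy : IsBounding y) (hconn : G.Connected)
    (hne : ¬ AllKnown y) (hl : 1 ≤ level y) :
    ∃ d₀, ∀ d, (IsUnknown (f d) d ↔ IsUnknown y d) → level y < level (f d) →
      d = d₀ ∧ level (f d) ≤ level y + 1 := by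
  have hne' : ∃ s, HasUnknown y s := by
    simp only [AllKnown, not_forall, not_not] at hne
    obtain ⟨d, hd⟩ := hne
    exact ⟨d.fst, d, rfl, hd⟩
  have ht : ∃ v, HasToken y v := by
    by_contra h; rw [level_eq_zero_of_not_exists h] at hl; omega
  obtain ⟨v, hv, hgap⟩ := exists_gap_eq_level ht
  have hvu : ¬ HasUnknown y v := fun h => by rw [gap_eq_zero h] at hgap; omega
  obtain ⟨g, rfl, hg⟩ := exists_dart_gap_succ_eq hconn hne' hvu
  have hgk := isKnown_of_gap_succ_eq hconn hne' hy _ g rfl hgap.le hg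
  have key : ∀ d, (IsUnknown (f d) d ↔ IsUnknown y d) → level y < level (f d) →
      d.snd = g.fst ∧ IsKnown y d.symm ∧ d.symm ≠ g ∧
      (∀ e, e.fst = g.fst → IsKnown y e → e ≠ d.symm → e = g) ∧ level (f d) ≤ level y + 1 := by
    intro d hd hlt
    rcases hf.eq_or_flip hy hl hd with h | ⟨hfd, hk, d', hfst, hk', hn⟩
    · rw [h] at hlt; omega
    rw [hfd] at hlt ⊢
    have hT1 := level_le_gap (hasToken_flip_fst hy hk)
    rw [gap_congr (isUnknown_flip hk)] at hT1
    have hsnd : d.snd = g.fst := by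
      by_contra h
      have := level_le_gap (hasToken_flip_of_ne hk hv (Ne.symm h))
      rw [gap_congr (isUnknown_flip hk)] at this
      omega
    have hthird : ∀ e, e.fst = g.fst → IsKnown y e → e ≠ d.symm → e = d' := by
      intro e he hek hen
      by_contra hed
      have hT : HasToken (insert d (y.erase d.symm)) g.fst :=
        ⟨e, he, isKnown_flip_of_ne hek hen, Or.inr ⟨d', hfst.trans hsnd,
          isKnown_flip_of_ne hk' hn, Ne.symm hed⟩⟩
      have := level_le_gap hT
      rw [gap_congr (isUnknown_flip hk)] at this
      omega
    have hdg : d.symm ≠ g := by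
      rintro h
      have : g.snd = d.fst := by rw [← h]; rfl
      rw [this] at hg
      omega
    have hgd : g = d' := hthird g rfl hgk hdg.symm
    refine ⟨hsnd, hk, hdg, fun e he hek hen => (hthird e he hek hen).trans hgd.symm, ?_⟩
    have := gap_le_succ_of_adj hconn hne' d.adj
    change gap y d.fst ≤ gap y d.snd + 1 at this
    rw [hsnd] at this
    omega
  by_cases hex : ∃ d, (IsUnknown (f d) d ↔ IsUnknown y d) ∧ level y < level (f d)
  · obtain ⟨d₀, hd₀, hlt₀⟩ := hex
    refine ⟨d₀, fun d hd hlt => ?_⟩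
    obtain ⟨h1, h2, h3, h4, h5⟩ := key d hd hlt
    obtain ⟨h1', h2', h3', h4', h5'⟩ := key d₀ hd₀ hlt₀
    refine ⟨?_, h5⟩
    by_contra hdd
    exact h3 (h4' d.symm h1 h2 fun h => hdd (SimpleGraph.Dart.symm_involutive.injective h))
  · exact ⟨g, fun d hd hlt => absurd ⟨d, hd, hlt⟩ hex⟩

/-- An edge that becomes unknown is matched by one that may become known. -/
lemma exists_gain_of_loss (hf : IsRefinement y f) (hy : IsBounding y) {d : G.Dart}
    (h1 : ¬ IsUnknown y d) (h2 : IsUnknown (f d) d) :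
    IsKnown y d.symm ∧ (¬ ∃ d', IsKnown y d' ∧ d'.fst = d.snd ∧ d'.edge ≠ d.edge) ∧
    ∃ d' : G.Dart, d'.snd = d.snd ∧ d'.edge ≠ d.edge ∧ IsUnknown y d' ∧ ¬ IsUnknown (f d') d' := by
  have hs : ¬ ∃ d', IsKnown y d' ∧ d'.fst = d.snd ∧ d'.edge ≠ d.edge := fun hs => by
    rw [hf.success d hs] at h2
    exact (isKnown_insert_erase y d).not_isUnknown h2
  have hk : IsKnown y d.symm := by
    rcases hy.isKnown_or h1 with h | h
    · rw [hf.keep d hs h] at h2; exact absurd h2 h1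
    · exact h
  refine ⟨hk, hs, ?_⟩
  by_contra hcon
  refine h1 ?_
  rw [hf.failure d hs] at h2
  · exact h2
  rintro ⟨d', hu, hfst, hedge⟩
  refine hcon ⟨d'.symm, hfst, by simpa using hedge, isUnknown_symm.2 hu, ?_⟩
  rw [hf.success d'.symm ⟨d.symm, hk, hfst.symm, by simpa using hedge.symm⟩]
  exact (isKnown_insert_erase y d'.symm).not_isUnknown

section Drift

variable [Fintype V] [DecidableRel G.Adj]

/-- There are at least as many draws that make an edge known as draws that make one unknown. -/
lemma card_loss_le_card_gain (hf : IsRefinement y f) (hy : IsBounding y) :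
    (Finset.univ.filter fun d => ¬ IsUnknown y d ∧ IsUnknown (f d) d).card ≤
      (Finset.univ.filter fun d => IsUnknown y d ∧ ¬ IsUnknown (f d) d).card := by
  have h : ∀ d : G.Dart, ∃ d' : G.Dart, (¬ IsUnknown y d ∧ IsUnknown (f d) d) →
      d'.snd = d.snd ∧ IsUnknown y d' ∧ ¬ IsUnknown (f d') d' := by
    intro d
    by_cases hd : ¬ IsUnknown y d ∧ IsUnknown (f d) d
    · obtain ⟨-, -, d', h1, -, h2⟩ := hf.exists_gain_of_loss hy hd.1 hd.2
      exact ⟨d', fun _ => ⟨h1, h2⟩⟩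
    · exact ⟨d, fun h => absurd h hd⟩
  choose φ hφ using h
  refine Finset.card_le_card_of_injOn φ ?_ ?_
  · intro d hd
    simp only [Finset.coe_filter, Finset.mem_univ, true_and, Set.mem_ofPred_eq] at hd ⊢
    exact (hφ d hd).2
  · intro d hd e he hde
    simp only [Finset.coe_filter, Finset.mem_univ, true_and, Set.mem_ofPred_eq] at hd he
    have hsnd : d.snd = e.snd := by rw [← (hφ d hd).1, ← (hφ e he).1, hde]
    obtain ⟨hk, -, -⟩ := hf.exists_gain_of_loss hy hd.1 hd.2
    obtain ⟨-, hs, -⟩ := hf.exists_gain_of_loss hy he.1 he.2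
    by_contra hne
    refine hs ⟨d.symm, hk, hsnd, ?_⟩
    rw [Ne, edge_eq_iff_of_fst_eq_snd (d := e) (e := d.symm) hsnd]
    exact fun h => hne (SimpleGraph.Dart.symm_involutive.injective h)

/-- With a token next to an unknown edge, or without tokens, some edge may become known. -/
lemma exists_gain_of_level_eq_zero (hf : IsRefinement y f) (hy : IsBounding y)
    (hconn : G.Connected) (hdeg : ∀ v, 2 ≤ G.degree v) (hne : ¬ AllKnown y)
    (h0 : AllUnknown y → ∃ d, IsUnknown y d ∧ ¬ IsUnknown (f d) d) (hl : level y = 0) :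
    ∃ d, IsUnknown y d ∧ ¬ IsUnknown (f d) d := by
  by_cases ht : ∃ v, HasToken y v
  · obtain ⟨v, ⟨e, he, hk, -⟩, hgap⟩ := exists_gap_eq_level ht
    have hne' : ∃ s, HasUnknown y s := by
      simp only [AllKnown, not_forall, not_not] at hne
      obtain ⟨d, hd⟩ := hne
      exact ⟨d.fst, d, rfl, hd⟩
    obtain ⟨d, hd, hu⟩ := hasUnknown_of_gap_eq_zero hconn hne' (hgap.trans hl)
    refine ⟨d.symm, isUnknown_symm.2 hu, ?_⟩
    rw [hf.success d.symm ⟨e, hk, he.trans hd.symm, ?_⟩]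
    · exact (isKnown_insert_erase y d.symm).not_isUnknown
    · rw [SimpleGraph.Dart.edge_symm]
      intro h
      exact hk.not_isUnknown ((isUnknown_of_edge_eq h).2 hu)
  · exact h0 (allUnknown_of_not_exists_hasToken hconn hdeg hy hne ht)

end Drift

end IsRefinement

end SinkFree

namespace SinkFree

variable {V : Type*} {G : SimpleGraph V} [Fintype V] [DecidableRel G.Adj]

lemma card_le_card_dart (hdeg : ∀ v, 2 ≤ G.degree v) : Fintype.card V ≤ Fintype.card G.Dart := by
  rw [G.dart_card_eq_sum_degrees, ← Finset.card_univ, Finset.card_eq_sum_ones]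
  exact Finset.sum_le_sum fun v _ => (by decide : 1 ≤ 2).trans (hdeg v)

lemma level_le (hconn : G.Connected) (hdeg : ∀ v, 2 ≤ G.degree v) (y : Finset G.Dart) :
    (level y : ℤ) ≤ Fintype.card G.Dart := by
  exact_mod_cast (level_le_card hconn y).trans (card_le_card_dart hdeg)

variable [DecidableEq V]

/-- The potential of a bounding state.  The first summand is concave in the number of known edges,
which is a submartingale; the second one is concave in the level, which is a supermartingale while
it is positive and no edge becomes known or unknown. -/
noncomputable def potential (y : Finset G.Dart) : ℤ :=
  2 * (Fintype.card G.Dart : ℤ) ^ 3 * ((Fintype.card G.Dart : ℤ) ^ 2 - ((settled y).card : ℤ) ^ 2)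
    + (level y : ℤ) * (2 * Fintype.card G.Dart + 1 - level y)

lemma AllKnown.potential_eq_zero {y : Finset G.Dart} (h : AllKnown y) : potential y = 0 := by
  simp [potential, h.card_settled, level_eq_zero_of_allKnown h]

lemma potential_nonneg (hconn : G.Connected) (hdeg : ∀ v, 2 ≤ G.degree v) (y : Finset G.Dart) :
    0 ≤ potential y := by
  have h1 : ((settled y).card : ℤ) ≤ Fintype.card G.Dart := by exact_mod_cast card_settled_le y
  have h2 := level_le hconn hdeg y
  have h3 : (0 : ℤ) ≤ (Fintype.card G.Dart : ℤ) ^ 2 - ((settled y).card : ℤ) ^ 2 :=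
    sub_nonneg.2 (pow_le_pow_left₀ (by positivity) h1 2)
  have h4 : (0 : ℤ) ≤ 2 * Fintype.card G.Dart + 1 - level y := by linarith
  unfold potential
  positivity

lemma level_term_le {M l : ℤ} (h1 : l ≤ M) : l * (2 * M + 1 - l) ≤ M * (M + 1) := by
  nlinarith [mul_nonneg (sub_nonneg.2 h1) (by linarith : (0 : ℤ) ≤ M + 1 - l)]

lemma potential_le (hconn : G.Connected) (hdeg : ∀ v, 2 ≤ G.degree v) (y : Finset G.Dart) :
    potential y ≤ 4 * (Fintype.card G.Dart : ℤ) ^ 5 := by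
  have hl := level_term_le (level_le hconn hdeg y)
  unfold potential
  generalize (level y : ℤ) * (2 * Fintype.card G.Dart + 1 - level y) = t at hl ⊢
  rcases Nat.eq_zero_or_pos (Fintype.card G.Dart) with h | h
  · rw [h] at hl ⊢; simpa using hl
  have hM : (1 : ℤ) ≤ Fintype.card G.Dart := by exact_mod_cast h
  generalize (Fintype.card G.Dart : ℤ) = M at *
  have h2 : M ^ 1 ≤ M ^ 5 := pow_le_pow_right₀ hM (by norm_num)
  have h3 : M ^ 2 ≤ M ^ 5 := pow_le_pow_right₀ hM (by norm_num)
  have h4 : 0 ≤ 2 * M ^ 3 * ((settled y).card : ℤ) ^ 2 := by positivity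
  nlinarith

lemma sum_potential_add_one_le (hconn : G.Connected) (hdeg : ∀ v, 2 ≤ G.degree v)
    {y : Finset G.Dart} {f : G.Dart → Finset G.Dart} (hy : IsBounding y) (hf : IsRefinement y f)
    (hne : ¬ AllKnown y)
    (h0 : AllUnknown y → ∃ d, IsUnknown y d ∧ ¬ IsUnknown (f d) d) :
    ∑ d, potential (f d) + 1 ≤ Fintype.card G.Dart * potential y := by
  classical
  set u : G.Dart → ℤ := fun d => if IsUnknown y d ∧ ¬ IsUnknown (f d) d then 1 else 0 with hu
  set r : G.Dart → ℤ := fun d => if ¬ IsUnknown y d ∧ IsUnknown (f d) d then 1 else 0 with hr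
  set M : ℤ := (Fintype.card G.Dart : ℤ) with hM
  set k : ℤ := ((settled y).card : ℤ) with hk
  set t : G.Dart → ℤ := fun d => if IsUnknown (f d) d ↔ IsUnknown y d then
    (level (f d) : ℤ) * (2 * M + 1 - level (f d)) - (level y : ℤ) * (2 * M + 1 - level y)
    else 0 with ht
  have hlev : ∀ z : Finset G.Dart, (level z : ℤ) ≤ M := level_le hconn hdeg
  have hlev0 : ∀ z : Finset G.Dart, (0 : ℤ) ≤ (level z : ℤ) * (2 * M + 1 - level z) := fun z =>
    mul_nonneg (by positivity) (by linarith [hlev z, (by positivity : (0 : ℤ) ≤ level z)])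
  have hM0 : 0 ≤ M := by positivity
  have hstep : ∀ d, potential (f d) ≤ potential y
      + 2 * M ^ 3 * (-(4 * k + 4) * u d + (4 * k - 4) * r d) + M * (M + 1) * (u d + r d) + t d := by
    intro d
    have hfl := level_term_le (hlev (f d))
    have hyl := hlev0 y
    simp only [potential, ← hM, ← hk]
    by_cases h1 : IsUnknown y d <;> by_cases h2 : IsUnknown (f d) d
    · have hs := settled_eq_of_iff (hf.local_iff d) (iff_of_true h2 h1)
      simp only [hu, hr, ht, h1, h2, hs, ← hk, not_true, and_false, false_and, if_false, if_true,
        iff_self]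
      linarith
    · have hs : ((settled (f d)).card : ℤ) = k + 2 := by
        have := card_settled_eq_add_two (hf.local_iff d) h1 h2
        omega
      simp only [hu, hr, ht, h1, h2, hs, not_true, not_false_iff, and_true, and_false, if_false,
        if_true, iff_true]
      linarith
    · have hs : k = ((settled (f d)).card : ℤ) + 2 := by
        have := card_settled_eq_add_two (fun e he => (hf.local_iff d e he).symm) h2 h1
        omega
      have hs' : ((settled (f d)).card : ℤ) = k - 2 := by linarith
      simp only [hu, hr, ht, h1, h2, hs', not_true, not_false_iff, and_true, and_false, if_false,
        if_true, iff_false]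
      linarith
    · have hs := settled_eq_of_iff (hf.local_iff d) (iff_of_false h2 h1)
      simp only [hu, hr, ht, h1, h2, hs, ← hk, and_false, false_and, if_false, if_true,
        iff_self]
      linarith
  have hsum := Finset.sum_le_sum fun d (_ : d ∈ Finset.univ) => hstep d
  simp only [Finset.sum_add_distrib, ← Finset.mul_sum, Finset.sum_const, Finset.card_univ,
    nsmul_eq_mul] at hsum
  rw [← hM] at hsum
  set p : ℤ := ∑ d, u d with hp
  set q : ℤ := ∑ d, r d with hq
  have hpc : p = ((Finset.univ.filter fun d => IsUnknown y d ∧ ¬ IsUnknown (f d) d).card : ℤ) := by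
    rw [hp, hu, Finset.sum_boole]
  have hqc : q = ((Finset.univ.filter fun d => ¬ IsUnknown y d ∧ IsUnknown (f d) d).card : ℤ) := by
    rw [hq, hr, Finset.sum_boole]
  have hqp : q ≤ p := by
    rw [hpc, hqc]; exact_mod_cast hf.card_loss_le_card_gain hy
  have hq0 : 0 ≤ q := by rw [hqc]; positivity
  have hk0 : 0 ≤ k := by positivity
  have hM1 : 1 ≤ M := by
    simp only [AllKnown, not_forall, not_not] at hne
    obtain ⟨d, -⟩ := hne
    have := Fintype.card_pos_iff.2 ⟨d⟩
    omega
  have hM23 : M ^ 2 ≤ M ^ 3 := pow_le_pow_right₀ hM1 (by norm_num)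
  have hM13 : M ≤ M ^ 3 := le_self_pow₀ hM1 (by norm_num)
  have hmain : 2 * M ^ 3 * (-(4 * k + 4) * p + (4 * k - 4) * q) + M * (M + 1) * (p + q)
      ≤ -(6 * M ^ 3) * (p + q) := by
    have h1 : 0 ≤ 2 * M ^ 3 * (4 * k) * (p - q) :=
      mul_nonneg (by positivity) (sub_nonneg.2 hqp)
    have h2 : 0 ≤ (2 * M ^ 3 - M * (M + 1)) * (p + q) :=
      mul_nonneg (by nlinarith) (by linarith)
    linarith
  rcases Nat.eq_zero_or_pos (level y) with hl | hl
  · have hgain := hf.exists_gain_of_level_eq_zero hy hconn hdeg hne h0 hl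
    have hp1 : 1 ≤ p := by
      rw [hpc]
      obtain ⟨d, hd⟩ := hgain
      exact_mod_cast Finset.card_pos.2 ⟨d, by simpa using hd⟩
    have htle : ∑ d, t d ≤ M * (M * (M + 1)) := by
      have : ∑ d, t d ≤ ∑ _d : G.Dart, M * (M + 1) := by
        refine Finset.sum_le_sum fun d _ => ?_
        simp only [ht]
        split_ifs
        · linarith [level_term_le (hlev (f d)), hlev0 y]
        · positivity
      simpa [Finset.sum_const, Finset.card_univ, ← hM] using this
    have h6 : 6 * M ^ 3 * 1 ≤ 6 * M ^ 3 * (p + q) :=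
      mul_le_mul_of_nonneg_left (by linarith) (by positivity)
    nlinarith
  · obtain ⟨d₀, hd₀⟩ := hf.level_le_succ_and_unique hy hconn hne hl
    obtain ⟨d₁, hd₁, hlt₁⟩ := hf.exists_level_lt hy hconn hne hl
    have htle : ∑ d, t d ≤ ∑ d, ((if d = d₀ then 2 * (M - level y) else 0)
        - if d = d₁ then 2 * (M - level y) + 2 else 0) := by
      refine Finset.sum_le_sum fun d _ => ?_
      have hly := hlev y
      have hlf := hlev (f d)
      by_cases h1 : d = d₁
      · subst h1
        have hlt : (level (f d) : ℤ) + 1 ≤ level y := by exact_mod_cast hlt₁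
        simp only [ht, hd₁, iff_self, if_true]
        have : (0 : ℤ) ≤ if d = d₀ then 2 * (M - level y) else 0 := by split_ifs <;> linarith
        nlinarith [mul_nonneg (sub_nonneg.2 hlt)
          (by linarith : (0 : ℤ) ≤ 2 * M + 1 - (level y - 1) - level (f d))]
      · simp only [h1, if_false, sub_zero, ht]
        split_ifs with h2 h3 h3
        · by_cases hlt : level y < level (f d)
          · have h4 := (hd₀ d h2 hlt).2
            have : (level (f d) : ℤ) = level y + 1 := by
              exact_mod_cast (by omega : level (f d) = level y + 1)
            rw [this]; linarith
          · have : (level (f d) : ℤ) ≤ level y := by exact_mod_cast not_lt.1 hlt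
            nlinarith [mul_nonneg (sub_nonneg.2 this)
              (by linarith : (0 : ℤ) ≤ 2 * M + 1 - level y - level (f d))]
        · have hlt : ¬ level y < level (f d) := fun hlt => h3 (hd₀ d h2 hlt).1
          have : (level (f d) : ℤ) ≤ level y := by exact_mod_cast not_lt.1 hlt
          nlinarith [mul_nonneg (sub_nonneg.2 this)
            (by linarith : (0 : ℤ) ≤ 2 * M + 1 - level y - level (f d))]
        · linarith
        · exact le_rfl
    rw [Finset.sum_sub_distrib, Finset.sum_ite_eq', Finset.sum_ite_eq'] at htle
    simp only [Finset.mem_univ, if_true] at htle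
    have h6 : 0 ≤ 6 * M ^ 3 * (p + q) := mul_nonneg (by positivity) (by linarith)
    linarith

end SinkFree

namespace SinkFree

section Bounding

variable {V : Type*} {G : SimpleGraph V} [Fintype V] [DecidableEq V] [DecidableRel G.Adj]

lemma mem_boundingStep_of_edge_ne {y : Finset G.Dart} {d e : G.Dart} (h : e.edge ≠ d.edge) :
    e ∈ boundingStep y d ↔ e ∈ y := by
  have h1 : e ≠ d := fun h' => h (by rw [h'])
  unfold boundingStep
  split_ifs
  · exact mem_insert_erase_of_edge_ne h
  · simp [h1]
  · rfl

lemma IsBounding.boundingStep_total {y : Finset G.Dart} (hy : IsBounding y) (d e : G.Dart) :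
    e ∈ boundingStep y d ∨ e.symm ∈ boundingStep y d := by
  by_cases he : e.edge = d.edge
  · have key : d ∈ boundingStep y d ∨ d.symm ∈ boundingStep y d := by
      unfold boundingStep
      split_ifs
      · exact Or.inl (Finset.mem_insert_self _ _)
      · exact Or.inl (Finset.mem_insert_self _ _)
      · exact hy.total d
    rcases (SimpleGraph.dart_edge_eq_iff _ _).1 he with rfl | rfl
    · exact key
    · simpa [or_comm] using key
  · rw [mem_boundingStep_of_edge_ne he, mem_boundingStep_of_edge_ne (by simpa using he)]
    exact hy.total e

lemma IsBounding.isRefinement_boundingStep {y : Finset G.Dart} (hy : IsBounding y) :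
    IsRefinement y (boundingStep y) where
  total := hy.boundingStep_total
  local_iff _ _ h := mem_boundingStep_of_edge_ne h
  success _ h := if_pos h
  failure d h h' := by rw [boundingStep, if_neg h, if_neg h']
  keep d h hk := by
    rw [boundingStep, if_neg h]
    split_ifs
    · exact Finset.insert_eq_of_mem hk.1
    · rfl

lemma IsBounding.boundingStep {y : Finset G.Dart} (hy : IsBounding y) (d : G.Dart) :
    IsBounding (boundingStep y d) where
  total := hy.boundingStep_total d
  noSink v := by
    have hloc : ∀ e : G.Dart, e.edge ≠ d.edge → (e ∈ SinkFree.boundingStep y d ↔ e ∈ y) :=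
      fun e => mem_boundingStep_of_edge_ne
    by_cases hother : v = d.fst ∨ v = d.snd
    · by_cases hk : ∃ d', IsKnown y d' ∧ d'.fst = d.snd ∧ d'.edge ≠ d.edge
      · right
        rcases hother with rfl | rfl
        · refine ⟨d, rfl, ?_⟩
          rw [hy.isRefinement_boundingStep.success d hk]
          exact isKnown_insert_erase y d
        · obtain ⟨d', hd', hfst, hne⟩ := hk
          exact ⟨d', hfst, (isKnown_congr_of_edge_ne hloc hne).2 hd'⟩
      · by_cases hu : ∃ d', IsUnknown y d' ∧ d'.fst = d.snd ∧ d'.edge ≠ d.edge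
        · rcases hother with rfl | rfl
          · have hd : d ∈ SinkFree.boundingStep y d := by
              rw [SinkFree.boundingStep, if_neg hk, if_pos hu]
              exact Finset.mem_insert_self _ _
            by_cases hs : d.symm ∈ SinkFree.boundingStep y d
            · exact Or.inl ⟨d, rfl, hd, hs⟩
            · exact Or.inr ⟨d, rfl, hd, hs⟩
          · obtain ⟨d', hd', hfst, hne⟩ := hu
            exact Or.inl ⟨d', hfst, (isUnknown_congr_of_edge_ne hloc hne).2 hd'⟩
        · rw [hy.isRefinement_boundingStep.failure d hk hu]
          exact hy.noSink v
    · have hne : ∀ e : G.Dart, e.fst = v → e.edge ≠ d.edge := by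
        rintro e rfl he
        rcases (SimpleGraph.dart_edge_eq_iff _ _).1 he with rfl | rfl
        · exact hother (Or.inl rfl)
        · exact hother (Or.inr rfl)
      rcases hy.noSink v with ⟨e, he, hu⟩ | ⟨e, he, hk⟩
      · exact Or.inl ⟨e, he, (isUnknown_congr_of_edge_ne hloc (hne e he)).2 hu⟩
      · exact Or.inr ⟨e, he, (isKnown_congr_of_edge_ne hloc (hne e he)).2 hk⟩

lemma AllKnown.boundingStep {y : Finset G.Dart} (h : AllKnown y) (d : G.Dart) :
    AllKnown (boundingStep y d) := by
  intro e
  by_cases he : e.edge = d.edge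
  · rw [isUnknown_of_edge_eq he]
    unfold SinkFree.boundingStep
    split_ifs with h1 h2
    · exact (isKnown_insert_erase y d).not_isUnknown
    · obtain ⟨d', hu, -⟩ := h2
      exact absurd hu (h d')
    · exact h d
  · rw [isUnknown_congr_of_edge_ne (fun e => mem_boundingStep_of_edge_ne) he]
    exact h e

lemma exists_dart_edge_ne (hdeg : ∀ v, 2 ≤ G.degree v) (v : V) (d : G.Dart) :
    ∃ e : G.Dart, e.fst = v ∧ e.edge ≠ d.edge := by
  have h := hdeg v
  rw [← G.dart_fst_fiber_card_eq_degree] at h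
  obtain ⟨a, ha, b, hb, hab⟩ := Finset.one_lt_card.1 h
  simp only [Finset.mem_filter, Finset.mem_univ, true_and] at ha hb
  by_cases h : a.edge = d.edge
  · exact ⟨b, hb, fun h' =>
      hab ((edge_eq_iff_of_fst_eq (ha.trans hb.symm)).1 (h.trans h'.symm))⟩
  · exact ⟨a, ha, h⟩

lemma mem_startSuccess_of_edge_ne {d e : G.Dart} (h : e.edge ≠ d.edge) : e ∈ startSuccess d := by
  have : e ≠ d.symm := fun h' => h (by rw [h', SimpleGraph.Dart.edge_symm])
  simp [startSuccess, this]

lemma isUnknown_startSuccess {d e : G.Dart} (h : e.edge ≠ d.edge) :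
    IsUnknown (startSuccess d) e :=
  ⟨mem_startSuccess_of_edge_ne h, mem_startSuccess_of_edge_ne (by simpa using h)⟩

lemma isBounding_startSuccess (hdeg : ∀ v, 2 ≤ G.degree v) (d : G.Dart) :
    IsBounding (startSuccess d) where
  total e := by
    by_cases h : e = d.symm
    · subst h; right; simp [startSuccess, d.symm_ne.symm]
    · left; simp [startSuccess, h]
  noSink v := by
    obtain ⟨e, he, hne⟩ := exists_dart_edge_ne hdeg v d
    exact Or.inl ⟨e, he, isUnknown_startSuccess hne⟩

lemma not_allUnknown_startSuccess (d : G.Dart) : ¬ AllUnknown (startSuccess d) := fun h => by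
  simpa [startSuccess] using (h d).2

lemma not_allKnown_startSuccess (hdeg : ∀ v, 2 ≤ G.degree v) (d : G.Dart) :
    ¬ AllKnown (startSuccess d) := fun h => by
  obtain ⟨e, -, hne⟩ := exists_dart_edge_ne hdeg d.fst d
  exact h e (isUnknown_startSuccess hne)

lemma mem_startFailure {d e : G.Dart} :
    e ∈ startFailure d ↔ e = d.symm ∨ (e.fst ≠ d.snd ∧ e ≠ d) := by
  simp [startFailure]

lemma not_mem_startFailure (d : G.Dart) : d ∉ startFailure d := by
  simp [mem_startFailure, d.symm_ne.symm]

lemma isBounding_startFailure (hdeg : ∀ v, 2 ≤ G.degree v) (d : G.Dart) :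
    IsBounding (startFailure d) where
  total e := by
    simp only [mem_startFailure]
    by_cases h1 : e = d
    · subst h1; simp
    by_cases h2 : e = d.symm
    · exact Or.inl (Or.inl h2)
    by_cases h3 : e.fst = d.snd
    · refine Or.inr (Or.inr ⟨?_, fun h => h2 (by rw [← h, SimpleGraph.Dart.symm_symm])⟩)
      rw [← h3]; exact e.fst_ne_snd.symm
    · exact Or.inl (Or.inr ⟨h3, h1⟩)
  noSink v := by
    by_cases hv : v = d.snd
    · exact Or.inr ⟨d.symm, hv.symm, mem_startFailure.2 (Or.inl rfl),
        by rw [SimpleGraph.Dart.symm_symm]; exact not_mem_startFailure d⟩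
    · obtain ⟨e, rfl, hne⟩ := exists_dart_edge_ne hdeg v d
      have he : e ∈ startFailure d :=
        mem_startFailure.2 (Or.inr ⟨hv, fun h => hne (by rw [h])⟩)
      by_cases hs : e.symm ∈ startFailure d
      · exact Or.inl ⟨e, rfl, he, hs⟩
      · exact Or.inr ⟨e, rfl, he, hs⟩

lemma not_allUnknown_startFailure (d : G.Dart) : ¬ AllUnknown (startFailure d) := fun h =>
  not_mem_startFailure d (h d).1

end Bounding

section Orientation

variable {V : Type*} {G : SimpleGraph V}

/-- Every edge has exactly one direction, and there is no sink. -/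
structure IsOrientation (x : Finset G.Dart) : Prop where
  mem_symm_iff : ∀ d, d.symm ∈ x ↔ d ∉ x
  noSink : ∀ v, ∃ d ∈ x, d.fst = v

lemma IsBounding.isOrientation {y : Finset G.Dart} (hy : IsBounding y) (h : AllKnown y) :
    IsOrientation y where
  mem_symm_iff d := by
    have h1 := hy.total d
    have h2 := h d
    simp only [IsUnknown] at h2
    tauto
  noSink v := by
    rcases hy.noSink v with ⟨d, -, hd⟩ | ⟨d, hd, hk⟩
    · exact absurd hd (h d)
    · exact ⟨d, hk.1, hd⟩

variable [DecidableEq V]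

lemma mem_gibbsStep_of_edge_ne {x : Finset G.Dart} {d e : G.Dart} (h : e.edge ≠ d.edge) :
    e ∈ gibbsStep x d ↔ e ∈ x := by
  unfold gibbsStep
  split_ifs
  · exact mem_insert_erase_of_edge_ne h
  · rfl

lemma IsOrientation.gibbsStep {x : Finset G.Dart} (hx : IsOrientation x) (d : G.Dart) :
    IsOrientation (gibbsStep x d) := by
  by_cases hs : ∃ d' ∈ x, d'.fst = d.snd ∧ d'.edge ≠ d.edge
  · have h1 : SinkFree.gibbsStep x d = insert d (x.erase d.symm) := if_pos hs
    refine ⟨fun e => ?_, fun v => ?_⟩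
    · by_cases he : e.edge = d.edge
      · rw [h1]
        rcases (SimpleGraph.dart_edge_eq_iff _ _).1 he with rfl | rfl
        · simp [e.symm_ne]
        · simp [d.symm_ne]
      · rw [mem_gibbsStep_of_edge_ne he, mem_gibbsStep_of_edge_ne (by simpa using he)]
        exact hx.mem_symm_iff e
    · obtain ⟨e, he, rfl⟩ := hx.noSink v
      by_cases hed : e = d.symm
      · obtain ⟨d', hd', hfst, hne⟩ := hs
        exact ⟨d', (mem_gibbsStep_of_edge_ne hne).2 hd', by rw [hfst, hed]; rfl⟩
      · exact ⟨e, by rw [h1]; simp [he, hed], rfl⟩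
  · rw [SinkFree.gibbsStep, if_neg hs]; exact hx

variable {x₁ x₂ : Finset G.Dart}

lemma IsOrientation.isKnown_union_iff (h₁ : IsOrientation x₁) (h₂ : IsOrientation x₂) (d : G.Dart) :
    IsKnown (x₁ ∪ x₂) d ↔ d ∈ x₁ ∧ d ∈ x₂ := by
  simp only [IsKnown, Finset.mem_union, h₁.mem_symm_iff, h₂.mem_symm_iff]
  tauto

lemma IsOrientation.isUnknown_union_iff (h₁ : IsOrientation x₁) (h₂ : IsOrientation x₂)
    (d : G.Dart) : IsUnknown (x₁ ∪ x₂) d ↔ ¬ (d ∈ x₁ ↔ d ∈ x₂) := by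
  simp only [IsUnknown, Finset.mem_union, h₁.mem_symm_iff, h₂.mem_symm_iff]
  tauto

lemma IsOrientation.allKnown_union_iff (h₁ : IsOrientation x₁) (h₂ : IsOrientation x₂) :
    AllKnown (x₁ ∪ x₂) ↔ x₁ = x₂ := by
  simp only [AllKnown, h₁.isUnknown_union_iff h₂, not_not, Finset.ext_iff]

lemma IsOrientation.isBounding_union (h₁ : IsOrientation x₁) (x₂ : Finset G.Dart) :
    IsBounding (x₁ ∪ x₂) where
  total d := by
    simp only [Finset.mem_union, h₁.mem_symm_iff]
    tauto
  noSink v := by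
    obtain ⟨d, hd, hv⟩ := h₁.noSink v
    by_cases hs : d.symm ∈ x₁ ∪ x₂
    · exact Or.inl ⟨d, hv, Finset.mem_union_left _ hd, hs⟩
    · exact Or.inr ⟨d, hv, Finset.mem_union_left _ hd, hs⟩

lemma IsOrientation.gibbsStep_eq_of_mem (h₁ : IsOrientation x₁) {d : G.Dart} (hd : d ∈ x₁) :
    SinkFree.gibbsStep x₁ d = x₁ := by
  have : d.symm ∉ x₁ := fun h => (h₁.mem_symm_iff d).1 h hd
  unfold SinkFree.gibbsStep
  split_ifs
  · exact insert_erase_eq_of_isKnown ⟨hd, this⟩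
  · rfl

lemma IsOrientation.isRefinement_gibbsStep (h₁ : IsOrientation x₁) (h₂ : IsOrientation x₂) :
    IsRefinement (x₁ ∪ x₂) fun d => SinkFree.gibbsStep x₁ d ∪ SinkFree.gibbsStep x₂ d where
  total d := ((h₁.gibbsStep d).isBounding_union _).total
  local_iff d e h := by
    simp only [Finset.mem_union, mem_gibbsStep_of_edge_ne h]
  success d hs := by
    obtain ⟨d', hk, hfst, hne⟩ := hs
    rw [h₁.isKnown_union_iff h₂] at hk
    rw [SinkFree.gibbsStep, if_pos ⟨d', hk.1, hfst, hne⟩, SinkFree.gibbsStep,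
      if_pos ⟨d', hk.2, hfst, hne⟩, Finset.erase_union_distrib, Finset.insert_union_distrib]
  failure d hk hu := by
    have key : ∀ d' ∈ x₁ ∪ x₂, ¬ (d'.fst = d.snd ∧ d'.edge ≠ d.edge) := by
      intro d' hd' h
      by_cases hs : d'.symm ∈ x₁ ∪ x₂
      · exact hu ⟨d', ⟨hd', hs⟩, h⟩
      · exact hk ⟨d', ⟨hd', hs⟩, h⟩
    rw [SinkFree.gibbsStep, if_neg, SinkFree.gibbsStep, if_neg]
    · rintro ⟨d', hd', h⟩; exact key d' (Finset.mem_union_right _ hd') h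
    · rintro ⟨d', hd', h⟩; exact key d' (Finset.mem_union_left _ hd') h
  keep d _ hk := by
    rw [h₁.isKnown_union_iff h₂] at hk
    rw [h₁.gibbsStep_eq_of_mem hk.1, h₂.gibbsStep_eq_of_mem hk.2]

/-- Two opposite orientations can be made to agree on an edge at a vertex of degree at least `3`. -/
lemma IsOrientation.exists_gain_of_allUnknown [Fintype V] [DecidableRel G.Adj]
    (h₁ : IsOrientation x₁) (h₂ : IsOrientation x₂) (hdeg : ∃ v, 3 ≤ G.degree v)
    (h : AllUnknown (x₁ ∪ x₂)) :
    ∃ d, IsUnknown (x₁ ∪ x₂) d ∧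
      ¬ IsUnknown (SinkFree.gibbsStep x₁ d ∪ SinkFree.gibbsStep x₂ d) d := by
  have key : ∀ {x₁ x₂ : Finset G.Dart}, IsOrientation x₁ → IsOrientation x₂ →
      (∀ d, ¬ (d ∈ x₁ ↔ d ∈ x₂)) → ∀ a ∈ x₁, ∀ b ∈ x₁, a.fst = b.fst → a ≠ b →
      (a.symm ∈ SinkFree.gibbsStep x₁ a.symm ↔ a.symm ∈ SinkFree.gibbsStep x₂ a.symm) := by
    intro x₁ x₂ h₁ h₂ h a ha b hb hab hne
    have hs : ∃ d' ∈ x₁, d'.fst = a.symm.snd ∧ d'.edge ≠ a.symm.edge :=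
      ⟨b, hb, hab.symm, by
        rw [SimpleGraph.Dart.edge_symm, Ne, edge_eq_iff_of_fst_eq hab.symm]; exact hne.symm⟩
    have ha2 : a.symm ∈ x₂ := by
      have := h a
      rw [h₂.mem_symm_iff]; tauto
    rw [SinkFree.gibbsStep, if_pos hs, h₂.gibbsStep_eq_of_mem ha2]
    simp [ha2]
  obtain ⟨v, hv⟩ := hdeg
  rw [← G.dart_fst_fiber_card_eq_degree] at hv
  have hu : ∀ d, ¬ (d ∈ x₁ ↔ d ∈ x₂) := fun d => (h₁.isUnknown_union_iff h₂ d).1 (h d)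
  suffices ∃ d : G.Dart, d ∈ SinkFree.gibbsStep x₁ d ↔ d ∈ SinkFree.gibbsStep x₂ d by
    obtain ⟨d, hd⟩ := this
    refine ⟨d, h d, ?_⟩
    rw [(h₁.gibbsStep d).isUnknown_union_iff (h₂.gibbsStep d), not_not]
    exact hd
  obtain ⟨a, b, c, ha, hb, hc, hab, hac, hbc⟩ := Finset.two_lt_card_iff.1 hv
  simp only [Finset.mem_filter, Finset.mem_univ, true_and] at ha hb hc
  have hu' : ∀ d, ¬ (d ∈ x₂ ↔ d ∈ x₁) := fun d h => hu d h.symm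
  have main : ∀ a b : G.Dart, a.fst = b.fst → a ≠ b → (a ∈ x₁ ↔ b ∈ x₁) →
      ∃ d : G.Dart, d ∈ SinkFree.gibbsStep x₁ d ↔ d ∈ SinkFree.gibbsStep x₂ d := by
    intro a b hfst hne hiff
    by_cases hax : a ∈ x₁
    · exact ⟨a.symm, key h₁ h₂ hu a hax b (hiff.1 hax) hfst hne⟩
    · have ha2 : a ∈ x₂ := by have := hu a; tauto
      have hb2 : b ∈ x₂ := by have := hu b; tauto
      exact ⟨a.symm, (key h₂ h₁ hu' a ha2 b hb2 hfst hne).symm⟩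
  by_cases h1 : a ∈ x₁ ↔ b ∈ x₁
  · exact main a b (ha.trans hb.symm) hab h1
  · by_cases h2 : a ∈ x₁ ↔ c ∈ x₁
    · exact main a c (ha.trans hc.symm) hac h2
    · exact main b c (hb.trans hc.symm) hbc (by tauto)

end Orientation

section Scheme

variable {V : Type*} {G : SimpleGraph V} [Fintype V] [DecidableEq V] [DecidableRel G.Adj]

/-- An invariant of the states of the scheme. -/
def SchemeState.Valid : SchemeState G → Prop
  | .phaseI => True
  | .phaseII y₁ y₂ => IsBounding y₁ ∧ IsBounding y₂ ∧ ¬ AllUnknown y₁ ∧ ¬ AllUnknown y₂ ∧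
      ¬ (AllKnown y₁ ∧ AllKnown y₂)
  | .phaseIII x₁ x₂ => IsOrientation x₁ ∧ IsOrientation x₂

/-- An upper bound for the expected number of remaining steps. -/
noncomputable def SchemeState.weight : SchemeState G → ℤ
  | .phaseI => 4 * (Fintype.card G.Dart : ℤ) ^ 6
      + 9 * (Fintype.card G.Dart : ℤ) ^ 6 * (Fintype.card G.Dart : ℤ) ^ 2
  | .phaseII y₁ y₂ => 4 * (Fintype.card G.Dart : ℤ) ^ 6 + 9 * (Fintype.card G.Dart : ℤ) ^ 6 *
      ((Fintype.card G.Dart : ℤ) ^ 2 - (settled y₁).card * (settled y₂).card)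
      + Fintype.card G.Dart * (potential y₁ + potential y₂)
  | .phaseIII x₁ x₂ => Fintype.card G.Dart * potential (x₁ ∪ x₂)

lemma SchemeState.Valid.step (hdeg : ∀ v, 2 ≤ G.degree v) {s : SchemeState G} (hs : s.Valid)
    (d : G.Dart × G.Dart) : (schemeStep s d).Valid := by
  match s with
  | .phaseI =>
    exact ⟨isBounding_startSuccess hdeg _, isBounding_startFailure hdeg _,
      not_allUnknown_startSuccess _, not_allUnknown_startFailure _,
      fun h => not_allKnown_startSuccess hdeg _ h.1⟩
  | .phaseII y₁ y₂ =>
    obtain ⟨h₁, h₂, -⟩ := hs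
    simp only [schemeStep]
    split_ifs with hu hk
    · trivial
    · exact ⟨(h₁.boundingStep _).isOrientation hk.1, (h₂.boundingStep _).isOrientation hk.2⟩
    · rw [not_or] at hu
      exact ⟨h₁.boundingStep _, h₂.boundingStep _, hu.1, hu.2, hk⟩
  | .phaseIII x₁ x₂ => exact ⟨hs.1.gibbsStep _, hs.2.gibbsStep _⟩

lemma card_settled_mul_le (y₁ y₂ : Finset G.Dart) :
    ((settled y₁).card : ℤ) * (settled y₂).card ≤ (Fintype.card G.Dart : ℤ) ^ 2 := by
  rw [pow_two]
  exact_mod_cast Nat.mul_le_mul (card_settled_le y₁) (card_settled_le y₂)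

lemma SchemeState.weight_nonneg (hconn : G.Connected) (hdeg : ∀ v, 2 ≤ G.degree v)
    (s : SchemeState G) : 0 ≤ s.weight := by
  match s with
  | .phaseI => unfold weight; positivity
  | .phaseII y₁ y₂ =>
    have h1 := potential_nonneg hconn hdeg y₁
    have h2 := potential_nonneg hconn hdeg y₂
    have h3 := sub_nonneg.2 (card_settled_mul_le y₁ y₂)
    unfold weight; positivity
  | .phaseIII x₁ x₂ =>
    have h1 := potential_nonneg hconn hdeg (x₁ ∪ x₂)
    unfold weight; positivity

lemma card_mul_potential_le (hconn : G.Connected) (hdeg : ∀ v, 2 ≤ G.degree v)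
    (y : Finset G.Dart) :
    (Fintype.card G.Dart : ℤ) * potential y ≤ 4 * (Fintype.card G.Dart : ℤ) ^ 6 := by
  have := mul_le_mul_of_nonneg_left (potential_le hconn hdeg y)
    (by positivity : (0 : ℤ) ≤ Fintype.card G.Dart)
  linarith

lemma weight_step_phaseII_le (hconn : G.Connected) (hdeg : ∀ v, 2 ≤ G.degree v)
    (y₁ y₂ : Finset G.Dart) (d : G.Dart × G.Dart) :
    (schemeStep (.phaseII y₁ y₂) d).weight ≤
      (SchemeState.phaseII (boundingStep y₁ d.1) (boundingStep y₂ d.2)).weight := by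
  have h1 := potential_nonneg hconn hdeg (boundingStep y₁ d.1)
  have h2 := potential_nonneg hconn hdeg (boundingStep y₂ d.2)
  have h3 := sub_nonneg.2 (card_settled_mul_le (boundingStep y₁ d.1) (boundingStep y₂ d.2))
  have h4 := mul_nonneg (Int.natCast_nonneg (Fintype.card G.Dart)) (add_nonneg h1 h2)
  simp only [schemeStep]
  split_ifs with hu hk
  · have : ((settled (boundingStep y₁ d.1)).card : ℤ) * (settled (boundingStep y₂ d.2)).card
        = 0 := by
      rcases hu with h | h <;> simp [h.card_settled]
    simp only [SchemeState.weight, this, sub_zero]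
    linarith
  · have h5 := card_mul_potential_le hconn hdeg (boundingStep y₁ d.1 ∪ boundingStep y₂ d.2)
    have h6 := mul_nonneg
      (by positivity : (0 : ℤ) ≤ 9 * (Fintype.card G.Dart : ℤ) ^ 6) h3
    simp only [SchemeState.weight]
    linarith
  · exact le_rfl

end Scheme

end SinkFree

namespace SinkFree

variable {V : Type*} {G : SimpleGraph V} [Fintype V] [DecidableEq V] [DecidableRel G.Adj]

/-- The number of known edges is a submartingale. -/
lemma IsRefinement.mul_card_settled_le_sum {y : Finset G.Dart} {f : G.Dart → Finset G.Dart}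
    (hf : IsRefinement y f) (hy : IsBounding y) :
    (Fintype.card G.Dart : ℤ) * (settled y).card ≤ ∑ d, ((settled (f d)).card : ℤ) := by
  classical
  have hstep : ∀ d, ((settled (f d)).card : ℤ) = (settled y).card
      + 2 * (if IsUnknown y d ∧ ¬ IsUnknown (f d) d then 1 else 0)
      - 2 * (if ¬ IsUnknown y d ∧ IsUnknown (f d) d then 1 else 0) := by
    intro d
    by_cases h1 : IsUnknown y d <;> by_cases h2 : IsUnknown (f d) d
    · simp [h1, h2, settled_eq_of_iff (hf.local_iff d) (iff_of_true h2 h1)]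
    · simp [h1, h2, card_settled_eq_add_two (hf.local_iff d) h1 h2]
    · simp [h1, h2, card_settled_eq_add_two (fun e he => (hf.local_iff d e he).symm) h2 h1]
    · simp [h1, h2, settled_eq_of_iff (hf.local_iff d) (iff_of_false h2 h1)]
  have hle : ((Finset.univ.filter fun d => ¬ IsUnknown y d ∧ IsUnknown (f d) d).card : ℤ) ≤
      (Finset.univ.filter fun d => IsUnknown y d ∧ ¬ IsUnknown (f d) d).card := by
    exact_mod_cast hf.card_loss_le_card_gain hy
  rw [Finset.sum_congr rfl fun d _ => hstep d, Finset.sum_sub_distrib, Finset.sum_add_distrib,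
    ← Finset.mul_sum, ← Finset.mul_sum, Finset.sum_boole, Finset.sum_boole, Finset.sum_const,
    Finset.card_univ, nsmul_eq_mul]
  linarith

lemma sum_potential_boundingStep_le (hconn : G.Connected) (hdeg : ∀ v, 2 ≤ G.degree v)
    {y : Finset G.Dart} (hy : IsBounding y) (hu : ¬ AllUnknown y) :
    ∑ d, potential (boundingStep y d) ≤ Fintype.card G.Dart * potential y ∧
    (¬ AllKnown y → ∑ d, potential (boundingStep y d) + 1 ≤ Fintype.card G.Dart * potential y) := by
  have h : ¬ AllKnown y →
      ∑ d, potential (boundingStep y d) + 1 ≤ Fintype.card G.Dart * potential y := fun hk =>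
    sum_potential_add_one_le hconn hdeg hy hy.isRefinement_boundingStep hk fun h => absurd h hu
  refine ⟨?_, h⟩
  by_cases hk : AllKnown y
  · simp [hk.potential_eq_zero, fun d => (hk.boundingStep d).potential_eq_zero]
  · linarith [h hk]

lemma sum_weight_phaseII_le (hconn : G.Connected) (hdeg : ∀ v, 2 ≤ G.degree v)
    {y₁ y₂ : Finset G.Dart} (h : (SchemeState.phaseII y₁ y₂).Valid) :
    ∑ d, (schemeStep (.phaseII y₁ y₂) d).weight + (Fintype.card G.Dart : ℤ) ^ 2 ≤
      (Fintype.card G.Dart : ℤ) ^ 2 * (SchemeState.phaseII y₁ y₂).weight := by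
  obtain ⟨h₁, h₂, hu₁, hu₂, hk⟩ := h
  have hp₁ := sum_potential_boundingStep_le hconn hdeg h₁ hu₁
  have hp₂ := sum_potential_boundingStep_le hconn hdeg h₂ hu₂
  have hc₁ := h₁.isRefinement_boundingStep.mul_card_settled_le_sum h₁
  have hc₂ := h₂.isRefinement_boundingStep.mul_card_settled_le_sum h₂
  have hle := Finset.sum_le_sum fun d (_ : d ∈ Finset.univ) =>
    weight_step_phaseII_le hconn hdeg y₁ y₂ d
  have hsum : ∑ d : G.Dart × G.Dart,
      (SchemeState.phaseII (boundingStep y₁ d.1) (boundingStep y₂ d.2)).weight =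
      (Fintype.card G.Dart : ℤ) ^ 2 * (4 * (Fintype.card G.Dart : ℤ) ^ 6)
      + 9 * (Fintype.card G.Dart : ℤ) ^ 6 * ((Fintype.card G.Dart : ℤ) ^ 2 *
        (Fintype.card G.Dart : ℤ) ^ 2 - (∑ d, ((settled (boundingStep y₁ d)).card : ℤ)) *
          (∑ d, ((settled (boundingStep y₂ d)).card : ℤ)))
      + Fintype.card G.Dart * (Fintype.card G.Dart * ∑ d, potential (boundingStep y₁ d) +
          Fintype.card G.Dart * ∑ d, potential (boundingStep y₂ d)) := by
    simp only [SchemeState.weight, Fintype.sum_prod_type, Finset.sum_add_distrib,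
      ← Finset.mul_sum, ← Finset.sum_mul, Finset.sum_sub_distrib, Finset.sum_const,
      Finset.card_univ, nsmul_eq_mul, Fintype.card_prod, Nat.cast_mul]
    ring
  rw [hsum] at hle
  have hprod := mul_le_mul hc₁ hc₂
    (mul_nonneg (Int.natCast_nonneg _) (Int.natCast_nonneg _))
    (Finset.sum_nonneg fun _ _ => Int.natCast_nonneg _)
  have hpot : ∑ d, potential (boundingStep y₁ d) + ∑ d, potential (boundingStep y₂ d) + 1 ≤
      Fintype.card G.Dart * potential y₁ + Fintype.card G.Dart * potential y₂ := by
    by_cases hk₁ : AllKnown y₁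
    · linarith [hp₁.1, hp₂.2 fun hk₂ => hk ⟨hk₁, hk₂⟩]
    · linarith [hp₁.2 hk₁, hp₂.1]
  have e1 := mul_le_mul_of_nonneg_left hpot
    (by positivity : (0 : ℤ) ≤ (Fintype.card G.Dart : ℤ) ^ 2)
  have e2 := mul_le_mul_of_nonneg_left hprod
    (by positivity : (0 : ℤ) ≤ 9 * (Fintype.card G.Dart : ℤ) ^ 6)
  refine (add_le_add hle le_rfl).trans ?_
  simp only [SchemeState.weight]
  linarith

lemma sum_weight_phaseIII (x₁ x₂ : Finset G.Dart) :
    ∑ d, (schemeStep (.phaseIII x₁ x₂) d).weight = (Fintype.card G.Dart : ℤ) ^ 2 *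
      ∑ d, potential (gibbsStep x₁ d ∪ gibbsStep x₂ d) := by
  simp only [schemeStep, SchemeState.weight, Fintype.sum_prod_type, ← Finset.mul_sum,
    Finset.sum_const, Finset.card_univ, nsmul_eq_mul]
  ring

lemma sum_weight_phaseI_le (hconn : G.Connected) (hdeg : ∀ v, 2 ≤ G.degree v) :
    ∑ d, (schemeStep (.phaseI : SchemeState G) d).weight + (Fintype.card G.Dart : ℤ) ^ 2 ≤
      (Fintype.card G.Dart : ℤ) ^ 2 * (SchemeState.phaseI : SchemeState G).weight := by
  have h : ∀ d : G.Dart × G.Dart, (schemeStep (.phaseI : SchemeState G) d).weight ≤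
      (SchemeState.phaseI : SchemeState G).weight - 1 := by
    intro d
    have h1 := card_mul_potential_le hconn hdeg (startSuccess d.1)
    have h2 := card_mul_potential_le hconn hdeg (startFailure d.1)
    have h3 : (1 : ℤ) ≤ (settled (startSuccess d.1)).card * (settled (startFailure d.1)).card := by
      exact_mod_cast Nat.mul_pos (card_settled_pos (not_allUnknown_startSuccess d.1))
        (card_settled_pos (not_allUnknown_startFailure d.1))
    have h4 : (1 : ℤ) ≤ (Fintype.card G.Dart : ℤ) ^ 6 :=
      one_le_pow₀ (by exact_mod_cast Fintype.card_pos_iff.2 ⟨d.1⟩)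
    have h5 := mul_le_mul_of_nonneg_left h3
      (by positivity : (0 : ℤ) ≤ 9 * (Fintype.card G.Dart : ℤ) ^ 6)
    simp only [schemeStep, SchemeState.weight]
    linarith
  have := Finset.sum_le_sum fun d (_ : d ∈ Finset.univ) => h d
  rw [Finset.sum_const, Finset.card_univ, Fintype.card_prod, nsmul_eq_mul, Nat.cast_mul] at this
  linarith

lemma sum_weight_le_of_detected {s : SchemeState G} (hs : s.Valid) (hd : s.Detected) :
    ∑ d, (schemeStep s d).weight ≤ (Fintype.card G.Dart : ℤ) ^ 2 * s.weight := by
  match s with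
  | .phaseI => exact hd.elim
  | .phaseII _ _ => exact hd.elim
  | .phaseIII x₁ x₂ =>
    obtain rfl : x₁ = x₂ := hd
    rw [sum_weight_phaseIII]
    have h : ∀ x : Finset G.Dart, IsOrientation x → potential x = 0 := fun x hx => by
      simpa using ((hx.allKnown_union_iff hx).2 rfl).potential_eq_zero
    simp [SchemeState.weight, h _ hs.1, fun d => h _ (hs.1.gibbsStep d)]

lemma sum_weight_add_le (hconn : G.Connected) (hdeg : ∀ v, 2 ≤ G.degree v)
    (hdeg3 : ∃ v, 3 ≤ G.degree v) {s : SchemeState G} (hs : s.Valid) (hd : ¬ s.Detected) :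
    ∑ d, (schemeStep s d).weight + (Fintype.card G.Dart : ℤ) ^ 2 ≤
      (Fintype.card G.Dart : ℤ) ^ 2 * s.weight := by
  match s with
  | .phaseI => exact sum_weight_phaseI_le hconn hdeg
  | .phaseII _ _ => exact sum_weight_phaseII_le hconn hdeg hs
  | .phaseIII x₁ x₂ =>
    obtain ⟨h₁, h₂⟩ := hs
    have := sum_potential_add_one_le hconn hdeg (h₁.isBounding_union x₂)
      (h₁.isRefinement_gibbsStep h₂) (fun h => hd ((h₁.allKnown_union_iff h₂).1 h))
      (h₁.exists_gain_of_allUnknown h₂ hdeg3)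
    rw [sum_weight_phaseIII]
    have h := mul_le_mul_of_nonneg_left this
      (by positivity : (0 : ℤ) ≤ (Fintype.card G.Dart : ℤ) ^ 2)
    simp only [SchemeState.weight]
    linarith

lemma schemeRun_valid (hdeg : ∀ v, 2 ≤ G.degree v) (draw : ℕ → G.Dart × G.Dart) (t : ℕ) :
    (schemeRun draw t).Valid := by
  induction t with
  | zero => trivial
  | succ t ih => exact ih.step hdeg _

lemma schemeRun_congr {draw draw' : ℕ → G.Dart × G.Dart} (t : ℕ)
    (h : ∀ i < t, draw i = draw' i) : schemeRun draw t = schemeRun draw' t := by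
  induction t with
  | zero => rfl
  | succ t ih =>
    rw [schemeRun, schemeRun, ih fun i hi => h i (by omega), h t (by omega)]

section Expectation

open Classical in
lemma detectionTime_le_tsum (draw : ℕ → G.Dart × G.Dart) :
    (detectionTime draw : ℝ≥0∞) ≤ ∑' t, if (schemeRun draw t).Detected then 0 else 1 := by
  by_cases h : ∃ t, (schemeRun draw t).Detected
  · have h1 : detectionTime draw ≤ (Nat.find h : ℕ∞) :=
      iInf₂_le (Nat.find h) (Nat.find_spec h)
    calc (detectionTime draw : ℝ≥0∞) ≤ ((Nat.find h : ℕ∞) : ℝ≥0∞) := ENat.toENNReal_mono h1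
      _ = ∑ t ∈ Finset.range (Nat.find h),
            if (schemeRun draw t).Detected then (0 : ℝ≥0∞) else 1 := by
          rw [Finset.sum_congr rfl fun t ht =>
            if_neg (Nat.find_min h (Finset.mem_range.1 ht))]
          simp
      _ ≤ _ := ENNReal.sum_le_tsum _
  · push Not at h
    simp [h]

/-- The expected detection time is at most the weight of the initial state. -/
lemma lintegral_detectionTime_le (hconn : G.Connected) (hdeg : ∀ v, 2 ≤ G.degree v)
    (hdeg3 : ∃ v, 3 ≤ G.degree v) {Ω : Type*} [MeasurableSpace Ω] (P : Measure Ω)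
    [IsProbabilityMeasure P] (draw : ℕ → Ω → G.Dart × G.Dart) (hmeas : ∀ t, Measurable (draw t))
    (hind : iIndepFun draw P)
    (hunif : ∀ t d, P (draw t ⁻¹' {d}) = (Fintype.card (G.Dart × G.Dart) : ℝ≥0∞)⁻¹) :
    ∫⁻ ω, (detectionTime (fun t => draw t ω) : ℝ≥0∞) ∂P ≤
      ((SchemeState.phaseI : SchemeState G).weight.toNat : ℝ≥0∞) := by
  classical
  obtain ⟨v, hv⟩ := hdeg3
  have hdart : Nonempty G.Dart := by
    obtain ⟨w, hw⟩ := (G.degree_pos_iff_exists_adj v).1 (by omega)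
    exact ⟨⟨(v, w), hw⟩⟩
  set N : ℕ := Fintype.card (G.Dart × G.Dart) with hN
  have hN0 : (N : ℝ≥0∞) ≠ 0 := by exact_mod_cast Fintype.card_ne_zero
  have hNM : (N : ℤ) = (Fintype.card G.Dart : ℤ) ^ 2 := by
    rw [hN, Fintype.card_prod, pow_two]; push_cast; rfl
  set W : SchemeState G → ℝ≥0∞ := fun s => (s.weight.toNat : ℝ≥0∞) with hW
  set I : SchemeState G → ℝ≥0∞ := fun s => if s.Detected then 0 else 1 with hI
  have hdrift : ∀ s : SchemeState G, s.Valid →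
      ∑ d, W (schemeStep s d) * (N : ℝ≥0∞)⁻¹ + I s ≤ W s := by
    intro s hs
    have key : ∑ d, (schemeStep s d).weight.toNat + (if s.Detected then 0 else N) ≤
        N * s.weight.toNat := by
      zify
      simp only [Int.toNat_of_nonneg (SchemeState.weight_nonneg hconn hdeg _), hNM]
      split_ifs with hd
      · simpa using sum_weight_le_of_detected hs hd
      · simpa [hNM] using sum_weight_add_le hconn hdeg ⟨v, hv⟩ hs hd
    have key' : ∑ d, W (schemeStep s d) + N * I s ≤ N * W s := by
      have : ((∑ d, (schemeStep s d).weight.toNat + (if s.Detected then 0 else N) : ℕ) : ℝ≥0∞) ≤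
        ((N * s.weight.toNat : ℕ) : ℝ≥0∞) := by exact_mod_cast key
      simp only [hW, hI]
      split_ifs at this ⊢ <;> push_cast at this ⊢ <;> simpa using this
    rw [← Finset.sum_mul]
    calc (∑ d, W (schemeStep s d)) * (N : ℝ≥0∞)⁻¹ + I s
        = (∑ d, W (schemeStep s d) + N * I s) * (N : ℝ≥0∞)⁻¹ := by
          rw [add_mul, mul_comm (N : ℝ≥0∞), mul_assoc,
            ENNReal.mul_inv_cancel hN0 (ENNReal.natCast_ne_top N), mul_one]
      _ ≤ (N * W s) * (N : ℝ≥0∞)⁻¹ := by gcongr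
      _ = W s := by
          rw [mul_comm (N : ℝ≥0∞), mul_assoc,
            ENNReal.mul_inv_cancel hN0 (ENNReal.natCast_ne_top N), mul_one]
  set run : ℕ → Ω → SchemeState G := fun t ω => schemeRun (fun i => draw i ω) t with hrun
  obtain ⟨d₀⟩ : Nonempty (G.Dart × G.Dart) := inferInstance
  set pre : (t : ℕ) → Ω → (Finset.range t → G.Dart × G.Dart) := fun t ω i => draw i ω with hpre
  have hprem : ∀ t, Measurable (pre t) := fun t => measurable_pi_lambda _ fun i => hmeas i
  set st : (t : ℕ) → (Finset.range t → G.Dart × G.Dart) → SchemeState G := fun t p =>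
    schemeRun (fun i => if h : i ∈ Finset.range t then p ⟨i, h⟩ else d₀) t with hst
  have hstrun : ∀ t ω, run t ω = st t (pre t ω) := by
    intro t ω
    refine schemeRun_congr t fun i hi => ?_
    rw [dif_pos (Finset.mem_range.2 hi)]
  have hind' : ∀ t, IndepFun (pre t) (draw t) P := by
    intro t
    have h := hind.indepFun_finset (Finset.range t) {t} (by simp) hmeas
    exact h.comp (φ := id) (ψ := fun p : ({t} : Finset ℕ) → G.Dart × G.Dart =>
      p ⟨t, Finset.mem_singleton_self t⟩) measurable_id (measurable_pi_apply _)
  have hstep : ∀ t, ∫⁻ ω, W (run (t + 1) ω) ∂P + ∫⁻ ω, I (run t ω) ∂P ≤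
      ∫⁻ ω, W (run t ω) ∂P := by
    intro t
    have hmap := (indepFun_iff_map_prod_eq_prod_map_map (hprem t).aemeasurable
      (hmeas t).aemeasurable).1 (hind' t)
    have hsucc : ∫⁻ ω, W (run (t + 1) ω) ∂P =
        ∫⁻ ω, ∑ d, W (schemeStep (run t ω) d) * (N : ℝ≥0∞)⁻¹ ∂P := by
      set F : (Finset.range t → G.Dart × G.Dart) × (G.Dart × G.Dart) → ℝ≥0∞ := fun q =>
        W (schemeStep (st t q.1) q.2) with hF
      have h1 : ∀ ω, W (run (t + 1) ω) = F (pre t ω, draw t ω) := by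
        intro ω
        simp only [hF, ← hstrun]
        rfl
      simp_rw [h1]
      rw [← lintegral_map (f := F) (g := fun ω => (pre t ω, draw t ω))
        (measurable_of_finite _) ((hprem t).prodMk (hmeas t))]
      rw [hmap,
        lintegral_prod _ (measurable_of_finite _).aemeasurable,
        lintegral_map (measurable_of_finite _) (hprem t)]
      refine lintegral_congr fun ω => ?_
      rw [lintegral_fintype]
      refine Finset.sum_congr rfl fun d _ => ?_
      rw [Measure.map_apply (hmeas t) (measurableSet_singleton d), hunif, hstrun]
    rw [hsucc, ← lintegral_add_left]
    · exact lintegral_mono fun ω => hdrift _ (schemeRun_valid hdeg _ t)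
    · simp_rw [hstrun]
      exact (measurable_of_finite fun p =>
        ∑ d, W (schemeStep (st t p) d) * (N : ℝ≥0∞)⁻¹).comp (hprem t)
  have hpartial : ∀ n, ∫⁻ ω, W (run n ω) ∂P + ∑ t ∈ Finset.range n, ∫⁻ ω, I (run t ω) ∂P ≤
      W .phaseI := by
    intro n
    induction n with
    | zero => simp [hrun, schemeRun]
    | succ n ih =>
      rw [Finset.sum_range_succ, add_comm (∑ t ∈ Finset.range n, _), ← add_assoc]
      exact (add_le_add_left (hstep n) _).trans ih
  calc ∫⁻ ω, (detectionTime (fun t => draw t ω) : ℝ≥0∞) ∂P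
      ≤ ∫⁻ ω, ∑' t, I (run t ω) ∂P := lintegral_mono fun ω => detectionTime_le_tsum _
    _ = ∑' t, ∫⁻ ω, I (run t ω) ∂P := by
        refine lintegral_tsum fun t => ?_
        simp_rw [hstrun]
        exact ((measurable_of_finite fun p => I (st t p)).comp (hprem t)).aemeasurable
    _ ≤ W .phaseI := ENNReal.tsum_le_of_sum_range_le fun n => le_add_self.trans (hpartial n)

end Expectation

end SinkFree

theorem theorem4 :
    ∃ C : NNReal,
      ∀ (V : Type*) [Fintype V] [DecidableEq V] (G : SimpleGraph V) [DecidableRel G.Adj],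
        G.Connected → (∀ v, 2 ≤ G.degree v) → (∃ v, 3 ≤ G.degree v) →
        ∀ (Ω : Type*) [MeasurableSpace Ω] (P : Measure Ω) [IsProbabilityMeasure P]
          (draw : ℕ → Ω → G.Dart × G.Dart),
          (∀ t, Measurable (draw t)) → iIndepFun draw P →
          (∀ t d, P (draw t ⁻¹' {d}) = (Fintype.card (G.Dart × G.Dart) : ℝ≥0∞)⁻¹) →
          ∫⁻ ω, (SinkFree.detectionTime (fun t => draw t ω) : ℝ≥0∞) ∂P
            ≤ C * (G.edgeFinset.card : ℝ≥0∞) ^ 9 := by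
  refine ⟨2560, fun V _ _ G _ hconn hdeg hdeg3 Ω _ P _ draw hmeas hind hunif => ?_⟩
  refine (SinkFree.lintegral_detectionTime_le hconn hdeg hdeg3 P draw hmeas hind hunif).trans ?_
  have hnat : (SinkFree.SchemeState.phaseI : SinkFree.SchemeState G).weight.toNat ≤
      2560 * G.edgeFinset.card ^ 9 := by
    rw [Int.toNat_le]
    simp only [SinkFree.SchemeState.weight, G.dart_card_eq_twice_card_edges]
    rcases Nat.eq_zero_or_pos G.edgeFinset.card with h | h
    · simp [h]
    · have h1 : (1 : ℤ) ≤ G.edgeFinset.card := by exact_mod_cast h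
      push_cast
      generalize (G.edgeFinset.card : ℤ) = m at h1
      have h6 : m ^ 6 ≤ m ^ 9 := pow_le_pow_right₀ h1 (by norm_num)
      have h8 : m ^ 8 ≤ m ^ 9 := pow_le_pow_right₀ h1 (by norm_num)
      ring_nf
      linarith
  calc ((SinkFree.SchemeState.phaseI : SinkFree.SchemeState G).weight.toNat : ℝ≥0∞)
      ≤ ((2560 * G.edgeFinset.card ^ 9 : ℕ) : ℝ≥0∞) := by exact_mod_cast hnat
    _ = _ := by push_cast; rfl
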